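/- **Setting.** Let $d,m,T$ be positive integers with $mTd\ge 2$, let $\|\cdot\|$ be the $L_q$ norm on $\mathbb R^d$ ($1\le q\le\infty$) with dual norm $\|\cdot\|_*$, and let $\mathbf 1_d$ be the all-ones vector. There are $m$ arms; arm $i$ has an unknown law $\nu_i$ on $[0,1]^d$ with mean $\mu_i$, the $i$-th column of the matrix $\mu\in[0,1]^{d\times m}$. In each round $t=1,\dots,T$ an arm $i_t$ is played on the basis of the past (possibly with randomization), and a vector $v_t$ is observed which, given $i_t$ and the past, has law $\nu_{i_t}$. In the problem BwR (bandits with concave rewards) a concave $f:[0,1]^d\to[0,1]$ with $f(x)-f(y)\le L\|x-y\|$ is given; $\mathrm{OPT}_f$ is the supremum over all non-anticipating policies of $\mathbb E f(\frac1T\sum_t v_t)$, and the average regret is $\mathrm{areg}_1(T)=\mathrm{OPT}_f-f(\frac1T\sum_t v_t)$. In the problem BwC (bandits with convex knapsacks) a convex $S\subseteq\mathbb R^d$ is given such that $\mu p^*\in S$ for some $p^*$ in the simplex $\Delta_m$, and the average regret is $\mathrm{areg}_2(T)=d(\frac1T\sum_t v_t,S)$, where $d(\cdot,S)$ is the distance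 in $\|\cdot\|$. **Algorithm.** For a parameter $\gamma>0$ let $\mathrm{rad}(x,N)=\sqrt{\gamma x/N}+\gamma/N$. Let $k_{t,i}$ be the number of plays of arm $i$ before round $t$, $\hat\mu_{t,ji}=\frac{1}{k_{t,i}+1}\sum_{s<t,\,i_s=i}v_{s,j}$, $\mathrm{UCB}_{t,ji}=\min\{1,\hat\mu_{t,ji}+2\,\mathrm{rad}(\hat\mu_{t,ji},k_{t,i}+1)\}$, $\mathrm{LCB}_{t,ji}=\max\{0,\hat\mu_{t,ji}-2\,\mathrm{rad}(\hat\mu_{t,ji},k_{t,i}+1)\}$, and let $H_t$ be the hypercube of all matrices $A$ with $\mathrm{LCB}_{t,ji}\le A_{ji}\le\mathrm{UCB}_{t,ji}$ for all $j,i$. Let $f^*(\theta)=\max_{y\in[0,1]^d}\{y\cdot\theta+f(y)\}$. Fix any online convex optimization (OCO) method on the domain $\{\|\theta\|_*\le L\}$. In round $t$ the Fenchel-dual algorithm for $f$ takes $\theta_t$ from the OCO method, given the earlier losses $g_1,\dots,g_{t-1}$; it chooses $(p_t,\tilde\mu_t)$ minimizing $\theta_t\cdot(Ap)$ over $p\in\Delta_m$,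 $A\in H_t$; it plays an arm drawn from $p_t$; and it sets $g_t(\theta)=f^*(\theta)-\theta\cdot x_t$ with $x_t=\tilde\mu_tp_t$. Let $\mathrm{Reg}_{OCO}(T)=\sum_{t\le T}g_t(\theta_t)-\min_{\|\theta\|_*\le L}\sum_{t\le T}g_t(\theta)$. **Theorem 3.** There are absolute constants $c_0,C>0$ such that for all $\delta\in(0,1)$ and $\gamma\ge c_0\ln(mTd/\delta)$ (in particular for some $\gamma=O(\ln(mTd/\delta))$) the following holds. For BwR, with probability at least $1-\delta$ the Fenchel-dual algorithm for $f$ satisfies $$\mathrm{areg}_1(T)\le C\,L\,\|\mathbf 1_d\|\sqrt{\frac{\gamma m}{T}}+\frac{\mathrm{Reg}_{OCO}(T)}{T}.$$ For BwC, with probability at least $1-\delta$ the Fenchel-dual algorithm for the function $x\mapsto-d(x,S)$ and with $L=1$ satisfies $$\mathrm{areg}_2(T)\le C\,\|\mathbf 1_d\|\sqrt{\frac{\gamma m}{T}}+\frac{\mathrm{Reg}_{OCO}(T)}{T}.$$ -/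

import Mathlib

open MeasureTheory ProbabilityTheory Matrix

noncomputable section

namespace BwCR

/-! ### Norms, distances and the Fenchel conjugate on `ℝ^d` -/

/-- The cube `[0,1]^d`. -/
def unitCube (d : ℕ) : Set (Fin d → ℝ) := Set.Icc 0 1

/-- The `L_q` norm on `ℝ^d`, `1 ≤ q ≤ ∞`. -/
def lqNorm (q : ENNReal) [Fact (1 ≤ q)] {d : ℕ} (x : Fin d → ℝ) : ℝ := ‖WithLp.toLp q x‖

/-- The dual norm of the `L_q` norm: `‖θ‖_* = sup {θ · x : ‖x‖ ≤ 1}`. -/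
def dualNorm (q : ENNReal) [Fact (1 ≤ q)] {d : ℕ} (θ : Fin d → ℝ) : ℝ :=
  sSup {r : ℝ | ∃ x : Fin d → ℝ, lqNorm q x ≤ 1 ∧ r = θ ⬝ᵥ x}

/-- The ball `{θ : ‖θ‖_* ≤ L}`, the domain of the online convex optimization problem. -/
def dualBall (q : ENNReal) [Fact (1 ≤ q)] (d : ℕ) (L : ℝ) : Set (Fin d → ℝ) :=
  {θ | dualNorm q θ ≤ L}

/-- The distance `d(x, S)` from a point to a set in the `L_q` norm. -/
def lqDist (q : ENNReal) [Fact (1 ≤ q)] {d : ℕ} (x : Fin d → ℝ) (S : Set (Fin d → ℝ)) : ℝ :=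
  Metric.infDist (WithLp.toLp q x) (WithLp.toLp q '' S)

/-- The Fenchel conjugate `f^*(θ) = max_{y ∈ [0,1]^d} (y · θ + f y)`. -/
def fenchel {d : ℕ} (f : (Fin d → ℝ) → ℝ) (θ : Fin d → ℝ) : ℝ :=
  sSup ((fun y => y ⬝ᵥ θ + f y) '' unitCube d)

/-! ### The bandit model

Rounds are numbered `0, …, T - 1`.  The σ-algebra `ℱ t` is what is known before round `t`.
The arms are `Fin m`; `ν i` is the law on `ℝ^d` of the observation when arm `i` is played. -/

/-- The `d × m` matrix whose `i`-th column is the mean observation of arm `i`. -/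
def meanMatrix {d m : ℕ} (ν : Fin m → Measure (Fin d → ℝ)) : Matrix (Fin d) (Fin m) ℝ :=
  Matrix.of fun j i => ∫ v, v j ∂(ν i)

/-- `I` (arms played) and `V` (observed vectors) come from a non-anticipating, possibly randomized
and adaptive, play of `T` rounds: given that arm `i` is played in round `t`, the observation has
law `ν i` and is independent of everything that happened before. -/
structure IsInteraction {d m : ℕ} (T : ℕ) (ν : Fin m → Measure (Fin d → ℝ))
    {Ω : Type*} [mΩ : MeasurableSpace Ω] (P : Measure Ω) (ℱ : Filtration ℕ mΩ)
    (I : ℕ → Ω → Fin m) (V : ℕ → Ω → Fin d → ℝ) : Prop where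
  arm_measurable : ∀ t < T, Measurable[ℱ (t + 1)] (I t)
  obs_measurable : ∀ t < T, Measurable[ℱ (t + 1)] (V t)
  obs_mem : ∀ t < T, ∀ ω, V t ω ∈ unitCube d
  obs_law : ∀ t < T, ∀ A : Set Ω, MeasurableSet[ℱ t] A → ∀ (i : Fin m) (B : Set (Fin d → ℝ)),
    MeasurableSet B →
      P (A ∩ {ω | I t ω = i} ∩ {ω | V t ω ∈ B}) = P (A ∩ {ω | I t ω = i}) * ν i B

/-- The average `(1/T) ∑_t v_t` of the observed vectors. -/
def avgObs {d : ℕ} (T : ℕ) (v : ℕ → Fin d → ℝ) : Fin d → ℝ :=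
  (T : ℝ)⁻¹ • ∑ t ∈ Finset.range T, v t

/-- `OPT_f`: the best expected value of `f((1/T) ∑_t v_t)` over all (adaptive, randomized,
non-anticipating) policies, which may know the distributions `ν`. -/
def optValue {d m : ℕ} (T : ℕ) (ν : Fin m → Measure (Fin d → ℝ)) (f : (Fin d → ℝ) → ℝ) : ℝ :=
  sSup {r : ℝ | ∃ (Ω : Type) (mΩ : MeasurableSpace Ω) (P : Measure Ω) (ℱ : Filtration ℕ mΩ)
    (I : ℕ → Ω → Fin m) (V : ℕ → Ω → Fin d → ℝ),
    IsProbabilityMeasure P ∧ IsInteraction T ν P ℱ I V ∧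
      r = ∫ ω, f (avgObs T fun t => V t ω) ∂P}

/-! ### Confidence bounds

Here `I` and `V` are one realization of the sequences of arms and observations. -/

/-- `k_{t,i}`: how often arm `i` was played before round `t`. -/
def plays {m : ℕ} (I : ℕ → Fin m) (t : ℕ) (i : Fin m) : ℕ :=
  {s ∈ Finset.range t | I s = i}.card

/-- The empirical average of component `j` for arm `i` (with `k_{t,i} + 1` in the denominator). -/
def empMean {d m : ℕ} (I : ℕ → Fin m) (V : ℕ → Fin d → ℝ) (t : ℕ) (j : Fin d) (i : Fin m) : ℝ :=
  (∑ s ∈ Finset.range t with I s = i, V s j) / ((plays I t i : ℝ) + 1)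

/-- The confidence radius `√(γ x / N) + γ / N`. -/
def rad (γ x N : ℝ) : ℝ := Real.sqrt (γ * x / N) + γ / N

/-- Upper confidence bound. -/
def ucb {d m : ℕ} (γ : ℝ) (I : ℕ → Fin m) (V : ℕ → Fin d → ℝ) (t : ℕ) (j : Fin d) (i : Fin m) :
    ℝ :=
  min 1 (empMean I V t j i + 2 * rad γ (empMean I V t j i) ((plays I t i : ℝ) + 1))

/-- Lower confidence bound. -/
def lcb {d m : ℕ} (γ : ℝ) (I : ℕ → Fin m) (V : ℕ → Fin d → ℝ) (t : ℕ) (j : Fin d) (i : Fin m) :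
    ℝ :=
  max 0 (empMean I V t j i - 2 * rad γ (empMean I V t j i) ((plays I t i : ℝ) + 1))

/-- The hypercube `H_t` of all matrices between the lower and the upper confidence bounds. -/
def confBox {d m : ℕ} (γ : ℝ) (I : ℕ → Fin m) (V : ℕ → Fin d → ℝ) (t : ℕ) :
    Set (Matrix (Fin d) (Fin m) ℝ) :=
  {A | ∀ j i, lcb γ I V t j i ≤ A j i ∧ A j i ≤ ucb γ I V t j i}

/-! ### Online convex optimization and the Fenchel dual algorithm -/

/-- An online convex optimization method on the domain `K`: it maps the list of the loss functions
revealed so far (and a source `Ξ` of internal randomness) to its next point in `K`. -/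
structure OCOMethod {d : ℕ} (K : Set (Fin d → ℝ)) (Ξ : Type*) where
  predict : Ξ → List ((Fin d → ℝ) → ℝ) → (Fin d → ℝ)
  predict_mem : ∀ ξ l, predict ξ l ∈ K

/-- The regret `∑_t g_t(θ_t) - min_{u ∈ K} ∑_t g_t(u)` of a sequence of points. -/
def ocoRegret {d : ℕ} (K : Set (Fin d → ℝ)) (T : ℕ) (g : ℕ → (Fin d → ℝ) → ℝ)
    (θ : ℕ → Fin d → ℝ) : ℝ :=
  ∑ t ∈ Finset.range T, g t (θ t) -
    sInf ((fun u => ∑ t ∈ Finset.range T, g t u) '' K)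

/-- The loss `g(θ) = f^*(θ) - θ · x`. -/
def dualLoss {d : ℕ} (f : (Fin d → ℝ) → ℝ) (x θ : Fin d → ℝ) : ℝ := fenchel f θ - θ ⬝ᵥ x

/-- `(θ, p, est, I, V)` is a run of `T` rounds of the Fenchel dual algorithm for `f`, with
confidence parameter `γ` and the online convex optimization method `oco` (with randomness `ξ`):
in round `t` it has `θ_t` from the method fed with the earlier losses, chooses `(p_t, est_t)`
minimizing `θ_t · (A p)` over the simplex and the hypercube `H_t`, plays an arm drawn from `p_t`,
and observes a vector drawn from the law of that arm. -/
structure IsDualRun {d m : ℕ} (T : ℕ) (ν : Fin m → Measure (Fin d → ℝ)) (γ : ℝ)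
    (f : (Fin d → ℝ) → ℝ) {K : Set (Fin d → ℝ)} {Ξ : Type*} (oco : OCOMethod K Ξ)
    {Ω : Type*} [mΩ : MeasurableSpace Ω] (P : Measure Ω) (ℱ : Filtration ℕ mΩ) (ξ : Ω → Ξ)
    (θ : ℕ → Ω → Fin d → ℝ) (p : ℕ → Ω → Fin m → ℝ) (est : ℕ → Ω → Matrix (Fin d) (Fin m) ℝ)
    (I : ℕ → Ω → Fin m) (V : ℕ → Ω → Fin d → ℝ) : Prop where
  interaction : IsInteraction T ν P ℱ I V
  theta_measurable : ∀ t < T, Measurable[ℱ t] (θ t)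
  prob_measurable : ∀ t < T, Measurable[ℱ t] (p t)
  est_measurable : ∀ t < T, ∀ j i, Measurable[ℱ t] (fun ω => est t ω j i)
  theta_eq : ∀ t < T, ∀ ω,
    θ t ω = oco.predict (ξ ω) ((List.range t).map fun s => dualLoss f (est s ω *ᵥ p s ω))
  prob_mem : ∀ t < T, ∀ ω, p t ω ∈ stdSimplex ℝ (Fin m)
  est_mem : ∀ t < T, ∀ ω, est t ω ∈ confBox γ (fun s => I s ω) (fun s => V s ω) t
  minimal : ∀ t < T, ∀ ω, ∀ p' ∈ stdSimplex ℝ (Fin m),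
    ∀ A ∈ confBox γ (fun s => I s ω) (fun s => V s ω) t,
      θ t ω ⬝ᵥ (est t ω *ᵥ p t ω) ≤ θ t ω ⬝ᵥ (A *ᵥ p')
  arm_law : ∀ t < T, ∀ A : Set Ω, MeasurableSet[ℱ t] A → ∀ i : Fin m,
    P (A ∩ {ω | I t ω = i}) = ∫⁻ ω in A, ENNReal.ofReal (p t ω i) ∂P

end BwCR

end

/-!
Let `x̄` be the average of `x_t = est_t p_t`. The minimum of `∑ g_t` over the dual ball is at most
`T f(x̄)`: a supergradient of `f` at `x̄` lies in the ball, by separation in the `L_q` norm, and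
attains it. On the other hand, as long as the mean matrix `M` stays in the confidence boxes,
`M p'` is never better than `x_t` in the direction `θ_t`, so `g_t(θ_t) ≥ f(M p')`. Hence
`f(M p') - f(x̄) ≤ Reg_OCO / T` for every mixture `p'`, and Jensen's inequality bounds `OPT_f` by
the best `f(M p')`.

It remains to compare `x̄` with the average of the observations. Two martingales with conditional
exponential moments of Bernstein type, the deviations of the observations from the means and of
the estimates at the arms drawn from their `p_t`-averages, are small with high probability;
together with the widths of the boxes, summed along the arms played, they contribute
`O(√(γ m / T))` in each coordinate.
-/

noncomputable section

namespace BwCR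

section Norm

variable (q : ENNReal) [Fact (1 ≤ q)] {d : ℕ}

lemma lqNorm_le_lqNorm_of_abs_le {x y : Fin d → ℝ} (h : ∀ j, |x j| ≤ |y j|) :
    lqNorm q x ≤ lqNorm q y := by
  unfold lqNorm
  rcases eq_or_ne q ⊤ with rfl | hq
  · simp only [PiLp.norm_toLp]
    exact (pi_norm_le_iff_of_nonneg (norm_nonneg _)).2 fun j => (h j).trans (norm_le_pi_norm y j)
  · have hq0 : 0 < q.toReal := ENNReal.toReal_pos (zero_lt_one.trans_le Fact.out).ne' hq
    simp only [PiLp.norm_eq_sum hq0, Real.norm_eq_abs]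
    exact Real.rpow_le_rpow (by positivity) (Finset.sum_le_sum fun j _ =>
      Real.rpow_le_rpow (abs_nonneg _) (h j) hq0.le) (by positivity)

lemma lqNorm_le_mul_lqNorm_one {x : Fin d → ℝ} {c : ℝ} (hc : 0 ≤ c) (h : ∀ j, |x j| ≤ c) :
    lqNorm q x ≤ c * lqNorm q (1 : Fin d → ℝ) :=
  calc lqNorm q x ≤ lqNorm q (c • (1 : Fin d → ℝ)) :=
        lqNorm_le_lqNorm_of_abs_le q fun j => by simpa [abs_of_nonneg hc] using h j
    _ = c * lqNorm q (1 : Fin d → ℝ) := by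
        rw [lqNorm, WithLp.toLp_smul, norm_smul, Real.norm_of_nonneg hc, lqNorm]

lemma lqNorm_sub_comm (x y : Fin d → ℝ) : lqNorm q (x - y) = lqNorm q (y - x) :=
  norm_sub_rev (WithLp.toLp q x) (WithLp.toLp q y)

lemma lqNorm_one_pos (hd : 0 < d) : 0 < lqNorm q (1 : Fin d → ℝ) :=
  norm_pos_iff.2 fun h => one_ne_zero (congrFun (congrArg WithLp.ofLp h) ⟨0, hd⟩)

variable {K : Set (Fin d → ℝ)} {f : (Fin d → ℝ) → ℝ} {L : ℝ}

lemma lipschitzOnWith_comp_ofLp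
    (hlip : ∀ x ∈ K, ∀ y ∈ K, f x - f y ≤ L * lqNorm q (x - y)) :
    LipschitzOnWith L.toNNReal (fun z : PiLp q fun _ : Fin d => ℝ => f z.ofLp)
      (WithLp.ofLp ⁻¹' K) :=
  LipschitzOnWith.of_le_add_mul' L fun x hx y hy => by
    rw [dist_eq_norm]
    exact sub_le_iff_le_add'.1 (hlip _ hx _ hy)

lemma continuousOn_of_sub_le_mul_lqNorm
    (hlip : ∀ x ∈ K, ∀ y ∈ K, f x - f y ≤ L * lqNorm q (x - y)) : ContinuousOn f K :=
  (lipschitzOnWith_comp_ofLp q hlip).continuousOn.comp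
    (PiLp.continuous_toLp q fun _ : Fin d => ℝ).continuousOn fun _ hx => hx

lemma zero_le_of_sub_le_mul_lqNorm (hd : 0 < d)
    (hlip : ∀ x ∈ unitCube d, ∀ y ∈ unitCube d, f x - f y ≤ L * lqNorm q (x - y)) : 0 ≤ L := by
  have h₀ : (0 : Fin d → ℝ) ∈ unitCube d := ⟨le_rfl, zero_le_one⟩
  have h₁ : (1 : Fin d → ℝ) ∈ unitCube d := ⟨zero_le_one, le_rfl⟩
  have h₀₁ := hlip 0 h₀ 1 h₁
  have h₁₀ := hlip 1 h₁ 0 h₀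
  rw [lqNorm_sub_comm] at h₀₁
  rw [sub_zero] at h₀₁ h₁₀
  exact nonneg_of_mul_nonneg_left (by linarith) (lqNorm_one_pos q hd)

end Norm

section Supergradient

lemma exists_affine_between {E : Type*} [AddCommGroup E] [Module ℝ E] [TopologicalSpace E]
    [IsTopologicalAddGroup E] [ContinuousSMul ℝ E] {K : Set E} {f h : E → ℝ} (hK : K.Nonempty)
    (hf : ConcaveOn ℝ K f) (hh : ConvexOn ℝ Set.univ h) (hcont : Continuous h)
    (hle : ∀ y ∈ K, f y ≤ h y) :
    ∃ (g : StrongDual ℝ E) (c : ℝ), (∀ y ∈ K, f y ≤ g y + c) ∧ ∀ z, g z + c ≤ h z := by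
  obtain ⟨φ, u, hepi, hhypo⟩ := geometric_hahn_banach_open hh.convex_strict_epigraph
    (by simpa using isOpen_lt (hcont.comp continuous_fst) continuous_snd) hf.convex_hypograph
    (Set.disjoint_left.2 fun z hz hz' => (hz'.2.trans (hle _ hz'.1)).not_gt hz.2)
  set s := φ (0, 1)
  have hφ (z : E) (r : ℝ) : φ (z, r) = φ (z, 0) + r * s := by
    rw [← smul_eq_mul, ← map_smul, ← map_add]
    simp
  have above {z : E} {r : ℝ} (hr : h z < r) : φ (z, 0) + r * s < u :=
    hφ z r ▸ hepi (z, r) ⟨Set.mem_univ z, hr⟩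
  have below {y : E} (hy : y ∈ K) : u ≤ φ (y, 0) + f y * s :=
    hφ y (f y) ▸ hhypo (y, f y) ⟨hy, le_rfl⟩
  have hs : s < 0 := by
    obtain ⟨y, hy⟩ := hK
    have := above (lt_add_one (h y))
    nlinarith [below hy, hle y hy]
  let g : StrongDual ℝ E := (-s⁻¹) • φ.comp (ContinuousLinearMap.inl ℝ E ℝ)
  have hg (z : E) : g z + u / s = (u - φ (z, 0)) / s := by
    simp only [g, FunLike.coe_smul, Pi.smul_apply, ContinuousLinearMap.comp_apply,
      ContinuousLinearMap.inl_apply, smul_eq_mul]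
    ring
  refine ⟨g, u / s, fun y hy => ?_, fun z => le_of_forall_gt fun r hr => ?_⟩
  · rw [hg, le_div_iff_of_neg hs]
    linarith [below hy]
  · rw [hg, div_lt_iff_of_neg hs]
    linarith [above hr]

lemma exists_supergradient {E : Type*} [NormedAddCommGroup E] [NormedSpace ℝ E] {K : Set E}
    {f : E → ℝ} {C : NNReal} (hf : ConcaveOn ℝ K f) (hlip : LipschitzOnWith C f K) {x : E}
    (hx : x ∈ K) : ∃ g : StrongDual ℝ E, ‖g‖ ≤ C ∧ ∀ y ∈ K, f y ≤ f x + g (y - x) := by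
  obtain ⟨g, c, hfg, hgh⟩ := exists_affine_between (h := fun z => f x + C * dist z x) ⟨x, hx⟩ hf
    ((convexOn_const _ convex_univ).add ((convexOn_univ_dist x).smul C.2)) (by fun_prop)
    fun y hy => hlip.le_add_mul hy hx
  have htight : g x + c = f x := le_antisymm (by simpa using hgh x) (hfg x hx)
  refine ⟨g, ContinuousLinearMap.opNorm_le_bound g C.2 fun v => abs_le.2 ⟨?_, ?_⟩, fun y hy => ?_⟩
  · have := hgh (x - v)
    simp only [map_sub, dist_eq_norm, sub_sub_cancel_left, norm_neg] at this
    linarith!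
  · have := hgh (x + v)
    simp only [map_add, dist_eq_norm, add_sub_cancel_left] at this
    linarith!
  · rw [map_sub]
    linarith [hfg y hy]

lemma exists_supergradient_mem_dualBall (q : ENNReal) [Fact (1 ≤ q)] {d : ℕ}
    {K : Set (Fin d → ℝ)} {f : (Fin d → ℝ) → ℝ} {L : ℝ} (hL : 0 ≤ L) (hf : ConcaveOn ℝ K f)
    (hlip : ∀ x ∈ K, ∀ y ∈ K, f x - f y ≤ L * lqNorm q (x - y)) {x : Fin d → ℝ} (hx : x ∈ K) :
    ∃ u ∈ dualBall q d L, ∀ y ∈ K, y ⬝ᵥ u + f y ≤ x ⬝ᵥ u + f x := by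
  let e := WithLp.linearEquiv q ℝ (Fin d → ℝ)
  obtain ⟨g, hgL, hg⟩ := exists_supergradient (hf.comp_linearMap e.toLinearMap)
    (lipschitzOnWith_comp_ofLp q hlip) (x := WithLp.toLp q x) hx
  rw [Real.coe_toNNReal L hL] at hgL
  let u : Fin d → ℝ :=
    (dotProductEquiv ℝ (Fin d)).symm (-(g.toLinearMap ∘ₗ e.symm.toLinearMap))
  have hu (y : Fin d → ℝ) : u ⬝ᵥ y = -g (WithLp.toLp q y) :=
    LinearMap.congr_fun ((dotProductEquiv ℝ (Fin d)).apply_symm_apply _) y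
  have hnorm : dualNorm q u ≤ L := by
    refine csSup_le (Set.nonempty_of_mem ⟨0, by simp [lqNorm], rfl⟩) ?_
    rintro _ ⟨y, hy, rfl⟩
    calc u ⬝ᵥ y = -g (WithLp.toLp q y) := hu y
      _ ≤ ‖g (WithLp.toLp q y)‖ := neg_le_abs _
      _ ≤ ‖g‖ * lqNorm q y := g.le_opNorm _
      _ ≤ L * 1 := mul_le_mul hgL hy (norm_nonneg _) hL
      _ = L := mul_one L
  refine ⟨u, hnorm, fun y hy => ?_⟩
  have := hg (WithLp.toLp q y) hy
  rw [map_sub] at this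
  rw [dotProduct_comm, hu, dotProduct_comm, hu]
  linarith!

end Supergradient

section OCO

variable {d T : ℕ} {f : (Fin d → ℝ) → ℝ}

lemma le_fenchel (hf : ContinuousOn f (unitCube d)) {y : Fin d → ℝ} (hy : y ∈ unitCube d)
    (θ : Fin d → ℝ) : y ⬝ᵥ θ + f y ≤ fenchel f θ :=
  le_csSup (isCompact_Icc.bddAbove_image (by unfold unitCube at hf; fun_prop)) ⟨y, hy, rfl⟩

lemma le_dualLoss (hf : ContinuousOn f (unitCube d)) {x y : Fin d → ℝ} (hy : y ∈ unitCube d)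
    {θ : Fin d → ℝ} (hθ : θ ⬝ᵥ x ≤ θ ⬝ᵥ y) : f y ≤ dualLoss f x θ := by
  have := le_fenchel hf hy θ
  rw [dotProduct_comm] at this
  unfold dualLoss
  linarith

lemma exists_dualLoss_le (q : ENNReal) [Fact (1 ≤ q)] {L : ℝ} (hL : 0 ≤ L)
    (hf : ConcaveOn ℝ (unitCube d) f)
    (hlip : ∀ x ∈ unitCube d, ∀ y ∈ unitCube d, f x - f y ≤ L * lqNorm q (x - y))
    {x : Fin d → ℝ} (hx : x ∈ unitCube d) : ∃ u ∈ dualBall q d L, dualLoss f x u ≤ f x := by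
  obtain ⟨u, hu, hmax⟩ := exists_supergradient_mem_dualBall q hL hf hlip hx
  refine ⟨u, hu, sub_le_iff_le_add'.2 ?_⟩
  rw [dotProduct_comm]
  exact csSup_le ⟨_, x, hx, rfl⟩ (Set.forall_mem_image.2 hmax)

lemma smul_avgObs (v : ℕ → Fin d → ℝ) : (T : ℝ) • avgObs T v = ∑ t ∈ Finset.range T, v t := by
  rcases eq_or_ne T 0 with rfl | hT
  · simp
  · exact smul_inv_smul₀ (Nat.cast_ne_zero.2 hT) _

lemma sum_dualLoss (x : ℕ → Fin d → ℝ) (u : Fin d → ℝ) :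
    ∑ t ∈ Finset.range T, dualLoss f (x t) u = T * dualLoss f (avgObs T x) u := by
  simp only [dualLoss, Finset.sum_sub_distrib, ← dotProduct_sum, ← smul_avgObs x,
    dotProduct_smul, Finset.sum_const, Finset.card_range, nsmul_eq_mul, smul_eq_mul, mul_sub]

lemma sInf_sum_dualLoss_le (q : ENNReal) [Fact (1 ≤ q)] {L : ℝ} (hL : 0 ≤ L)
    (hf : ConcaveOn ℝ (unitCube d) f)
    (hlip : ∀ x ∈ unitCube d, ∀ y ∈ unitCube d, f x - f y ≤ L * lqNorm q (x - y))
    {x : ℕ → Fin d → ℝ} (hx : avgObs T x ∈ unitCube d) :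
    sInf ((fun u => ∑ t ∈ Finset.range T, dualLoss f (x t) u) '' dualBall q d L)
      ≤ T * f (avgObs T x) := by
  simp only [sum_dualLoss]
  obtain ⟨u, hu, hux⟩ := exists_dualLoss_le q hL hf hlip hx
  have hbdd : BddBelow ((fun u => (T : ℝ) * dualLoss f (avgObs T x) u) '' dualBall q d L) := by
    refine ⟨T * f (avgObs T x), Set.forall_mem_image.2 fun w _ => ?_⟩
    gcongr
    exact le_dualLoss (continuousOn_of_sub_le_mul_lqNorm q hlip) hx le_rfl
  exact (csInf_le hbdd ⟨u, hu, rfl⟩).trans (mul_le_mul_of_nonneg_left hux T.cast_nonneg)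

lemma mul_sub_le_ocoRegret (q : ENNReal) [Fact (1 ≤ q)] {L : ℝ} (hL : 0 ≤ L)
    (hf : ConcaveOn ℝ (unitCube d) f)
    (hlip : ∀ x ∈ unitCube d, ∀ y ∈ unitCube d, f x - f y ≤ L * lqNorm q (x - y))
    {x θ : ℕ → Fin d → ℝ} (hx : avgObs T x ∈ unitCube d) {y : Fin d → ℝ}
    (hy : y ∈ unitCube d) (hmin : ∀ t < T, θ t ⬝ᵥ x t ≤ θ t ⬝ᵥ y) :
    T * (f y - f (avgObs T x)) ≤
      ocoRegret (dualBall q d L) T (fun t => dualLoss f (x t)) θ := by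
  have hplayed : T * f y ≤ ∑ t ∈ Finset.range T, dualLoss f (x t) (θ t) := by
    simpa using Finset.card_nsmul_le_sum (Finset.range T) _ _ fun t ht =>
      le_dualLoss (continuousOn_of_sub_le_mul_lqNorm q hlip) hy (hmin t (Finset.mem_range.1 ht))
  rw [ocoRegret, mul_sub]
  exact sub_le_sub hplayed (sInf_sum_dualLoss_le q hL hf hlip hx)

end OCO

section Convexity

variable {d m : ℕ} {K : Set (Fin d → ℝ)}

lemma avgObs_mem {T : ℕ} (hT : 0 < T) (hK : Convex ℝ K) {v : ℕ → Fin d → ℝ}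
    (hv : ∀ t < T, v t ∈ K) : avgObs T v ∈ K := by
  rw [avgObs, Finset.smul_sum]
  refine hK.sum_mem (fun _ _ => by positivity) ?_ fun t ht => hv t (Finset.mem_range.1 ht)
  simp [hT.ne']

lemma mulVec_mem (hK : Convex ℝ K) {A : Matrix (Fin d) (Fin m) ℝ} (hA : ∀ i, A.col i ∈ K)
    {p : Fin m → ℝ} (hp : p ∈ stdSimplex ℝ (Fin m)) : A *ᵥ p ∈ K := by
  simp only [mulVec_eq_sum, op_smul_eq_smul]
  exact hK.sum_mem (fun i _ => hp.1 i) hp.2 fun i _ => hA i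

lemma mulVec_mem_unitCube {A : Matrix (Fin d) (Fin m) ℝ} (hA : ∀ j i, A j i ∈ Set.Icc (0 : ℝ) 1)
    {p : Fin m → ℝ} (hp : p ∈ stdSimplex ℝ (Fin m)) : A *ᵥ p ∈ unitCube d :=
  mulVec_mem (convex_Icc 0 1) (fun i => ⟨fun j => (hA j i).1, fun j => (hA j i).2⟩) hp

lemma meanMatrix_apply_mem {ν : Fin m → Measure (Fin d → ℝ)} [∀ i, IsProbabilityMeasure (ν i)]
    (hcube : ∀ i, ∀ᵐ v ∂(ν i), v ∈ unitCube d) (j : Fin d) (i : Fin m) :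
    meanMatrix ν j i ∈ Set.Icc (0 : ℝ) 1 :=
  (convex_Icc 0 1).integral_mem isClosed_Icc
    ((hcube i).mono fun _ hv => ⟨hv.1 j, hv.2 j⟩)
    (Integrable.of_mem_Icc 0 1 (measurable_pi_apply j).aemeasurable
      ((hcube i).mono fun _ hv => ⟨hv.1 j, hv.2 j⟩))

variable (q : ENNReal) [Fact (1 ≤ q)] {S : Set (Fin d → ℝ)}

lemma lqDist_sub_le (S : Set (Fin d → ℝ)) (x y : Fin d → ℝ) :
    lqDist q x S - lqDist q y S ≤ lqNorm q (x - y) := by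
  rw [sub_le_iff_le_add', lqNorm, WithLp.toLp_sub, ← dist_eq_norm]
  exact Metric.infDist_le_infDist_add_dist

lemma lqDist_of_mem {x : Fin d → ℝ} (hx : x ∈ S) : lqDist q x S = 0 :=
  Metric.infDist_zero_of_mem (Set.mem_image_of_mem _ hx)

lemma convexOn_infDist {E : Type*} [SeminormedAddCommGroup E] [NormedSpace ℝ E] {S : Set E}
    (hS : Convex ℝ S) (hne : S.Nonempty) :
    ConvexOn ℝ Set.univ fun x => Metric.infDist x S := by
  refine ⟨convex_univ, fun x _ y _ a b ha hb hab => le_of_forall_pos_le_add fun ε hε => ?_⟩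
  obtain ⟨z, hz, hxz⟩ := (Metric.infDist_lt_iff hne).1 (lt_add_of_pos_right (Metric.infDist x S) hε)
  obtain ⟨w, hw, hyw⟩ := (Metric.infDist_lt_iff hne).1 (lt_add_of_pos_right (Metric.infDist y S) hε)
  calc Metric.infDist (a • x + b • y) S
      ≤ dist (a • x + b • y) (a • z + b • w) :=
        Metric.infDist_le_dist_of_mem (hS hz hw ha hb hab)
    _ ≤ dist (a • x) (a • z) + dist (b • y) (b • w) := dist_add_add_le _ _ _ _
    _ = a * dist x z + b * dist y w := by
        rw [dist_smul₀, dist_smul₀, Real.norm_of_nonneg ha, Real.norm_of_nonneg hb]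
    _ ≤ a * (Metric.infDist x S + ε) + b * (Metric.infDist y S + ε) := by gcongr
    _ = a • Metric.infDist x S + b • Metric.infDist y S + ε := by
        simp only [smul_eq_mul]
        linear_combination ε * hab

lemma convexOn_lqDist (hS : Convex ℝ S) (hne : S.Nonempty) :
    ConvexOn ℝ Set.univ fun x => lqDist q x S :=
  let e := (WithLp.linearEquiv q ℝ (Fin d → ℝ)).symm.toLinearMap
  (convexOn_infDist (hS.linear_image e) (hne.image e)).comp_linearMap e

end Convexity

section MeasureTheory

variable {α : Type*} {m₀ : MeasurableSpace α}

lemma sum_restrict_fiber {ι : Type*} [Fintype ι] [MeasurableSpace ι] [MeasurableSingletonClass ι]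
    (μ : Measure α) {I : α → ι} (hI : Measurable I) : ∑ i, μ.restrict {a | I a = i} = μ := by
  have hdisj : Pairwise (Function.onFun Disjoint fun i => {a | I a = i}) :=
    fun i j hij => Set.disjoint_left.2 fun a hi hj => hij (hi.symm.trans hj)
  rw [← Measure.sum_fintype, ← Measure.restrict_iUnion hdisj
    fun i => hI (measurableSet_singleton i), Set.iUnion_eq_univ_iff.2 fun a => ⟨I a, rfl⟩,
    Measure.restrict_univ]

lemma lintegral_congr_of_forall_measurableSet {m : MeasurableSpace α} (hm : m ≤ m₀)
    {μ ν : Measure[m₀] α} (h : ∀ A, MeasurableSet[m] A → μ A = ν A) {W : α → ENNReal}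
    (hW : Measurable[m] W) : ∫⁻ a, W a ∂μ = ∫⁻ a, W a ∂ν := by
  rw [← lintegral_trim hm hW, ← lintegral_trim hm hW]
  congr 1
  exact @Measure.ext _ m _ _ fun A hA => by
    rw [trim_measurableSet_eq hm hA, trim_measurableSet_eq hm hA, h A hA]

lemma integrable_comp_of_continuousOn {E : Type*} [TopologicalSpace E] [MeasurableSpace E]
    [OpensMeasurableSpace E] {μ : Measure α} [IsFiniteMeasure μ] {K : Set E} (hK : IsCompact K)
    {f : E → ℝ} (hf : ContinuousOn f K) {X : α → E} (hX : Measurable X) (hXK : ∀ a, X a ∈ K) :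
    Integrable (fun a => f (X a)) μ := by
  obtain ⟨c, hc⟩ := hK.exists_bound_of_continuousOn hf
  exact .of_bound (hf.domRestrict.measurable.comp (hX.subtype_mk (h := hXK))).aestronglyMeasurable c
    (ae_of_all _ fun a => hc _ (hXK a))

end MeasureTheory

section Interaction

variable {d m T : ℕ} {ν : Fin m → Measure (Fin d → ℝ)} {Ω : Type*} [mΩ : MeasurableSpace Ω]
  {P : Measure Ω} {ℱ : Filtration ℕ mΩ} {I : ℕ → Ω → Fin m} {V : ℕ → Ω → Fin d → ℝ}

namespace IsInteraction

lemma measurable_arm (h : IsInteraction T ν P ℱ I V) {t : ℕ} (ht : t < T) : Measurable (I t) :=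
  (h.arm_measurable t ht).mono (ℱ.le _) le_rfl

lemma measurable_obs (h : IsInteraction T ν P ℱ I V) {t : ℕ} (ht : t < T) : Measurable (V t) :=
  (h.obs_measurable t ht).mono (ℱ.le _) le_rfl

lemma measurable_avgObs (h : IsInteraction T ν P ℱ I V) :
    Measurable fun ω => avgObs T fun t => V t ω :=
  (Finset.measurable_fun_sum _ fun _ ht =>
    h.measurable_obs (Finset.mem_range.1 ht)).fun_const_smul (T : ℝ)⁻¹

lemma avgObs_mem_unitCube (h : IsInteraction T ν P ℱ I V) (hT : 0 < T) (ω : Ω) :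
    avgObs T (fun t => V t ω) ∈ unitCube d :=
  avgObs_mem hT (convex_Icc 0 1) fun t ht => h.obs_mem t ht ω

lemma integrable_comp_avgObs [IsFiniteMeasure P] (h : IsInteraction T ν P ℱ I V) (hT : 0 < T)
    {f : (Fin d → ℝ) → ℝ} (hf : ContinuousOn f (unitCube d)) :
    Integrable (fun ω => f (avgObs T fun t => V t ω)) P :=
  integrable_comp_of_continuousOn isCompact_Icc hf h.measurable_avgObs (h.avgObs_mem_unitCube hT)

lemma map_restrict (h : IsInteraction T ν P ℱ I V) {t : ℕ} (ht : t < T) (i : Fin m) :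
    (P.restrict {ω | I t ω = i}).map (V t) = P {ω | I t ω = i} • ν i := by
  ext B hB
  rw [Measure.map_apply (h.measurable_obs ht) hB,
    Measure.restrict_apply (h.measurable_obs ht hB), Set.inter_comm]
  have := h.obs_law t ht Set.univ .univ i B hB
  rwa [Set.univ_inter] at this

lemma integrable_obs [IsFiniteMeasure P] (h : IsInteraction T ν P ℱ I V) {t : ℕ} (ht : t < T)
    (j : Fin d) : Integrable (fun ω => V t ω j) P :=
  integrable_comp_of_continuousOn isCompact_Icc (continuous_apply j).continuousOn
    (h.measurable_obs ht) (h.obs_mem t ht)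

lemma integral_obs [IsFiniteMeasure P] (h : IsInteraction T ν P ℱ I V) {t : ℕ} (ht : t < T)
    (j : Fin d) :
    ∫ ω, V t ω j ∂P = (meanMatrix ν *ᵥ fun i => P.real {ω | I t ω = i}) j := by
  have hfiber (i : Fin m) :
      ∫ ω in {ω | I t ω = i}, V t ω j ∂P = meanMatrix ν j i * P.real {ω | I t ω = i} := by
    rw [← integral_map (h.measurable_obs ht).aemeasurable
      (measurable_pi_apply j).aestronglyMeasurable, h.map_restrict ht, integral_smul_measure,
      smul_eq_mul, mul_comm]
    rfl
  conv_lhs => rw [← sum_restrict_fiber P (h.measurable_arm ht)]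
  rw [integral_finsetSum_measure fun i _ => (h.integrable_obs ht j).restrict]
  exact Finset.sum_congr rfl fun i _ => hfiber i

end IsInteraction

/-- The expected frequency with which each arm is played during the first `T` rounds, that is,
the average of the laws of the arms `I 0, …, I (T - 1)`, a point of the simplex. -/
def armFreq (P : Measure Ω) (T : ℕ) (I : ℕ → Ω → Fin m) : Fin m → ℝ :=
  avgObs T fun t i => P.real {ω | I t ω = i}

namespace IsInteraction

lemma armFreq_mem_stdSimplex [IsProbabilityMeasure P] (h : IsInteraction T ν P ℱ I V)
    (hT : 0 < T) : armFreq P T I ∈ stdSimplex ℝ (Fin m) :=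
  avgObs_mem hT (convex_stdSimplex ℝ (Fin m)) fun t ht => ⟨fun _ => measureReal_nonneg,
    (sum_measureReal_preimage_singleton Finset.univ
      fun i _ => h.measurable_arm ht (measurableSet_singleton i)).trans (by simp)⟩

lemma integral_avgObs [IsFiniteMeasure P] (h : IsInteraction T ν P ℱ I V) (hT : 0 < T) :
    ∫ ω, avgObs T (fun t => V t ω) ∂P = meanMatrix ν *ᵥ armFreq P T I := by
  ext j
  rw [eval_integral fun j => h.integrable_comp_avgObs hT (continuous_apply j).continuousOn]
  simp only [avgObs, armFreq, mulVec_smul, mulVec_sum, Pi.smul_apply, Finset.sum_apply,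
    smul_eq_mul]
  rw [integral_const_mul, integral_finsetSum _ fun t ht =>
    h.integrable_obs (Finset.mem_range.1 ht) j]
  congr 1
  exact Finset.sum_congr rfl fun t ht => h.integral_obs (Finset.mem_range.1 ht) j

lemma integral_le [IsProbabilityMeasure P] (h : IsInteraction T ν P ℱ I V) (hT : 0 < T)
    {f : (Fin d → ℝ) → ℝ} (hf : ConcaveOn ℝ (unitCube d) f)
    (hcont : ContinuousOn f (unitCube d)) :
    ∫ ω, f (avgObs T fun t => V t ω) ∂P ≤ f (meanMatrix ν *ᵥ armFreq P T I) := by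
  rw [← h.integral_avgObs hT]
  exact hf.le_map_integral hcont isClosed_Icc (ae_of_all _ (h.avgObs_mem_unitCube hT))
    (.of_eval fun j => h.integrable_comp_avgObs hT (continuous_apply j).continuousOn)
    (h.integrable_comp_avgObs hT hcont)

end IsInteraction

lemma exists_isInteraction [∀ i, IsProbabilityMeasure (ν i)] (T : ℕ) (i₀ : Fin m)
    (hcube : ∀ᵐ v ∂(ν i₀), v ∈ unitCube d) :
    ∃ (Ω : Type) (mΩ : MeasurableSpace Ω) (P : Measure Ω) (ℱ : Filtration ℕ mΩ)
      (I : ℕ → Ω → Fin m) (V : ℕ → Ω → Fin d → ℝ),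
      IsProbabilityMeasure P ∧ IsInteraction T ν P ℱ I V := by
  let clamp : (Fin d → ℝ) → Fin d → ℝ := fun x j => max 0 (min 1 (x j))
  have hclamp : Measurable clamp := by unfold clamp; fun_prop
  have hclamp_ae : clamp =ᵐ[ν i₀] id := hcube.mono fun v hv => funext fun j =>
    (congrArg (max 0) (min_eq_right (hv.2 j))).trans (max_eq_right (hv.1 j))
  let P : Measure (ℕ → Fin d → ℝ) := Measure.infinitePi fun _ => ν i₀
  let X : ℕ → (ℕ → Fin d → ℝ) → Fin d → ℝ := fun t ω => ω t
  have hX (t : ℕ) : StronglyMeasurable (X t) := (measurable_pi_apply t).stronglyMeasurable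
  have hindep : iIndepFun X P := iIndepFun_infinitePi (fun _ => measurable_id)
  let ℱ := Filtration.natural X hX
  -- The coordinate `X 0` is a dummy: `ℱ t` is generated by `X 0, …, X t`.
  refine ⟨_, _, P, ℱ, fun _ _ => i₀, fun t ω => clamp (X (t + 1) ω), inferInstance,
    ⟨fun _ _ => measurable_const, fun t _ => ?_, fun t _ ω => ?_, fun t _ A hA i B hB => ?_⟩⟩
  · exact hclamp.comp (Filtration.stronglyAdapted_natural hX (t + 1)).measurable
  · exact ⟨fun _ => le_max_left .., fun _ => max_le zero_le_one (min_le_left ..)⟩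
  · rcases eq_or_ne i₀ i with rfl | hi
    · have hlaw : P (X (t + 1) ⁻¹' (clamp ⁻¹' B)) = ν i₀ B := by
        rw [← Measure.map_apply (hX _).measurable (hclamp hB), Measure.infinitePi_map_eval]
        exact measure_congr (hclamp_ae.preimage B)
      simp only [Set.ofPred_true, Set.inter_univ, ← hlaw]
      rw [Set.inter_comm, mul_comm]
      exact (Indep_iff _ _ P).1 (hindep.indep_comap_natural_of_lt hX t.lt_succ_self) _ _
        ⟨_, hclamp hB, rfl⟩ hA
    · simp [hi]

lemma optValue_le [∀ i, IsProbabilityMeasure (ν i)] (hT : 0 < T) (hm : 0 < m)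
    (hcube : ∀ i, ∀ᵐ v ∂(ν i), v ∈ unitCube d) {f : (Fin d → ℝ) → ℝ}
    (hf : ConcaveOn ℝ (unitCube d) f) (hcont : ContinuousOn f (unitCube d)) {b : ℝ}
    (hb : ∀ p ∈ stdSimplex ℝ (Fin m), f (meanMatrix ν *ᵥ p) ≤ b) : optValue T ν f ≤ b := by
  obtain ⟨Ω, mΩ, P, ℱ, I, V, hP, h⟩ := exists_isInteraction T ⟨0, hm⟩ (hcube _)
  refine csSup_le ⟨_, Ω, mΩ, P, ℱ, I, V, hP, h, rfl⟩ ?_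
  rintro _ ⟨Ω, mΩ, P, ℱ, I, V, hP, h, rfl⟩
  exact (h.integral_le hT hf hcont).trans (hb _ (h.armFreq_mem_stdSimplex hT))

end Interaction

section ExponentialMoments

lemma exp_mul_le {l a : ℝ} (hl : |l| ≤ 1) (ha : a ∈ Set.Icc (0 : ℝ) 1) :
    Real.exp (l * a) ≤ 1 + (l + l ^ 2) * a := by
  have hla : |l * a| ≤ 1 := by
    rw [abs_mul, abs_of_nonneg ha.1]
    exact mul_le_one₀ hl ha.1 ha.2
  have hexp := (abs_le.1 (Real.abs_exp_sub_one_sub_id_le hla)).2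
  have hsq : (l * a) ^ 2 ≤ l ^ 2 * a := by
    rw [mul_pow]
    exact mul_le_mul_of_nonneg_left (pow_le_of_le_one ha.1 ha.2 two_ne_zero) (sq_nonneg l)
  linarith

lemma exp_mul_sub_sub_le {l a : ℝ} (hl : |l| ≤ 1) (ha : a ∈ Set.Icc (0 : ℝ) 1) (y : ℝ) :
    Real.exp (l * (a - y) - l ^ 2 * y) ≤
      1 + (l + l ^ 2) * Real.exp (-((l + l ^ 2) * y)) * (a - y) := by
  set c := l + l ^ 2
  have hone : Real.exp (-(c * y)) * (1 + c * y) ≤ 1 :=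
    calc Real.exp (-(c * y)) * (1 + c * y) ≤ Real.exp (-(c * y)) * Real.exp (c * y) := by
          gcongr
          linarith [Real.add_one_le_exp (c * y)]
      _ = 1 := by rw [← Real.exp_add, neg_add_cancel, Real.exp_zero]
  calc Real.exp (l * (a - y) - l ^ 2 * y) = Real.exp (-(c * y)) * Real.exp (l * a) := by
        rw [← Real.exp_add]
        congr 1
        ring
    _ ≤ Real.exp (-(c * y)) * (1 + c * a) := by
        gcongr
        exact exp_mul_le hl ha
    _ = Real.exp (-(c * y)) * (1 + c * y) + c * Real.exp (-(c * y)) * (a - y) := by ring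
    _ ≤ 1 + c * Real.exp (-(c * y)) * (a - y) := by gcongr

lemma lintegral_exp_mul_sub_integral_le_one {Ω : Type*} [MeasurableSpace Ω] {P : Measure Ω}
    [IsProbabilityMeasure P] {X : Ω → ℝ} (hX : AEMeasurable X P)
    (hX01 : ∀ᵐ ω ∂P, X ω ∈ Set.Icc (0 : ℝ) 1) {l : ℝ} (hl : |l| ≤ 1) :
    ∫⁻ ω, ENNReal.ofReal (Real.exp (l * (X ω - P[X]) - l ^ 2 * P[X])) ∂P ≤ 1 := by
  set c := (l + l ^ 2) * Real.exp (-((l + l ^ 2) * P[X]))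
  have hle : ∀ᵐ ω ∂P, Real.exp (l * (X ω - P[X]) - l ^ 2 * P[X]) ≤ 1 + c * (X ω - P[X]) :=
    hX01.mono fun ω hω => exp_mul_sub_sub_le hl hω _
  have hint : Integrable X P := .of_mem_Icc 0 1 hX hX01
  have hsub : Integrable (fun ω => c * (X ω - P[X])) P :=
    (hint.sub (integrable_const _)).const_mul c
  calc ∫⁻ ω, ENNReal.ofReal (Real.exp (l * (X ω - P[X]) - l ^ 2 * P[X])) ∂P
      ≤ ∫⁻ ω, ENNReal.ofReal (1 + c * (X ω - P[X])) ∂P :=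
        lintegral_mono_ae (hle.mono fun _ h => ENNReal.ofReal_le_ofReal h)
    _ = ENNReal.ofReal (∫ ω, 1 + c * (X ω - P[X]) ∂P) :=
        (ofReal_integral_eq_lintegral_ofReal ((integrable_const 1).add hsub)
          (hle.mono fun _ h => (Real.exp_pos _).le.trans h)).symm
    _ = 1 := by
        rw [integral_add (integrable_const 1) hsub, integral_const_mul,
          integral_sub hint (integrable_const _)]
        simp

lemma sum_mul_exp_le_one {ι : Type*} [Fintype ι] {p a : ι → ℝ} (hp : p ∈ stdSimplex ℝ ι)
    (ha : ∀ i, a i ∈ Set.Icc (0 : ℝ) 1) {l : ℝ} (hl : |l| ≤ 1) :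
    ∑ i, p i * Real.exp (l * (a i - p ⬝ᵥ a) - l ^ 2) ≤ 1 := by
  set y := p ⬝ᵥ a
  set c := (l + l ^ 2) * Real.exp (-((l + l ^ 2) * y))
  have hy : y ≤ 1 := ((convex_Icc (0 : ℝ) 1).sum_mem (fun i _ => hp.1 i) hp.2 fun i _ => ha i).2
  have hexp (i : ι) : Real.exp (l * (a i - y) - l ^ 2) ≤ 1 + c * (a i - y) := by
    refine le_trans ?_ (exp_mul_sub_sub_le hl (ha i) y)
    gcongr
    exact mul_le_of_le_one_right (sq_nonneg l) hy
  calc ∑ i, p i * Real.exp (l * (a i - y) - l ^ 2) ≤ ∑ i, p i * (1 + c * (a i - y)) :=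
        Finset.sum_le_sum fun i _ => mul_le_mul_of_nonneg_left (hexp i) (hp.1 i)
    _ = (1 - c * y) * ∑ i, p i + c * ∑ i, p i * a i := by
        rw [Finset.mul_sum, Finset.mul_sum, ← Finset.sum_add_distrib]
        exact Finset.sum_congr rfl fun i _ => by ring
    _ = 1 := by
        rw [hp.2]
        change (1 - c * y) * 1 + c * y = 1
        ring

end ExponentialMoments

section Bernstein

variable {Ω : Type*} [mΩ : MeasurableSpace Ω] {P : Measure Ω} {ℱ : Filtration ℕ mΩ} {T : ℕ}
  {D v : ℕ → Ω → ℝ}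

/-- The increments `D t` have conditional exponential moments of Bernstein type with variance
proxies `v t`: for `|l| ≤ 1` the process `exp (∑ (l D t - l² v t))` is a supermartingale, which is
expressed by testing against nonnegative functions `W` known before round `t`. The proxy `v t` may
depend on what happens in round `t`. -/
structure HasBernsteinMoments (P : Measure Ω) (ℱ : Filtration ℕ mΩ) (T : ℕ) (D v : ℕ → Ω → ℝ) :
    Prop where
  measurable : ∀ t < T, Measurable[ℱ (t + 1)] (D t)
  measurable_proxy : ∀ t < T, Measurable[ℱ (t + 1)] (v t)
  lintegral_mul_exp_le : ∀ t < T, ∀ l : ℝ, |l| ≤ 1 → ∀ W : Ω → ENNReal, Measurable[ℱ t] W →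
    ∫⁻ ω, W ω * ENNReal.ofReal (Real.exp (l * D t ω - l ^ 2 * v t ω)) ∂P ≤ ∫⁻ ω, W ω ∂P

namespace HasBernsteinMoments

lemma measurable_exp_sum (h : HasBernsteinMoments P ℱ T D v) (l : ℝ) {n : ℕ} (hn : n ≤ T) :
    Measurable[ℱ n] fun ω => ENNReal.ofReal
      (Real.exp (∑ t ∈ Finset.range n, (l * D t ω - l ^ 2 * v t ω))) := by
  refine (Finset.measurable_fun_sum _ fun t ht => ?_).exp.ennreal_ofReal
  have ht := Finset.mem_range.1 ht
  exact (((h.measurable t (by lia)).const_mul l).sub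
    ((h.measurable_proxy t (by lia)).const_mul (l ^ 2))).mono (ℱ.mono ht) le_rfl

lemma lintegral_exp_sum_le_one [IsProbabilityMeasure P] (h : HasBernsteinMoments P ℱ T D v)
    {l : ℝ} (hl : |l| ≤ 1) {n : ℕ} (hn : n ≤ T) :
    ∫⁻ ω, ENNReal.ofReal
      (Real.exp (∑ t ∈ Finset.range n, (l * D t ω - l ^ 2 * v t ω))) ∂P ≤ 1 := by
  induction n with
  | zero => simp
  | succ n ih =>
    simp only [Finset.sum_range_succ, Real.exp_add, ENNReal.ofReal_mul (Real.exp_pos _).le]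
    exact (h.lintegral_mul_exp_le n hn l hl _ (h.measurable_exp_sum l (by lia))).trans
      (ih (by lia))

lemma measure_le_sum_le [IsProbabilityMeasure P] (h : HasBernsteinMoments P ℱ T D v) {l : ℝ}
    (hl : |l| ≤ 1) {n : ℕ} (hn : n ≤ T) (g : ℝ) :
    P {ω | g ≤ l * ∑ t ∈ Finset.range n, D t ω - l ^ 2 * ∑ t ∈ Finset.range n, v t ω} ≤
      ENNReal.ofReal (Real.exp (-g)) := by
  have hmarkov := (mul_meas_ge_le_lintegral ((h.measurable_exp_sum l hn).mono (ℱ.le n) le_rfl)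
    (ENNReal.ofReal (Real.exp g))).trans (h.lintegral_exp_sum_le_one hl hn)
  simp only [ENNReal.ofReal_le_ofReal_iff (Real.exp_pos _).le, Real.exp_le_exp,
    Finset.sum_sub_distrib, ← Finset.mul_sum] at hmarkov
  rw [Real.exp_neg, ENNReal.ofReal_inv_of_pos (Real.exp_pos g)]
  exact ENNReal.le_inv_iff_mul_le.2 (mul_comm (ENNReal.ofReal _) (P _) ▸ hmarkov)

end HasBernsteinMoments

-- `l = min 1 √(g / y)` balances the two terms of the bound `g / l + l y`.
lemma exists_forall_le_two_mul_sqrt_add {g : ℝ} (hg : 0 < g) (y : ℝ) :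
    ∃ l : ℝ, |l| ≤ 1 ∧ ∀ x, l * x - l ^ 2 * y < g → x ≤ 2 * √(g * y) + 2 * g := by
  rcases le_or_gt y g with hyg | hyg
  · exact ⟨1, by simp, fun x hx => by linarith [Real.sqrt_nonneg (g * y)]⟩
  · have hy : 0 < y := hg.trans hyg
    have hl : 0 < √(g / y) := Real.sqrt_pos.2 (div_pos hg hy)
    refine ⟨√(g / y), ?_, fun x hx => ?_⟩
    · rw [abs_of_pos hl]
      exact Real.sqrt_le_one.2 ((div_le_one hy).2 hyg.le)
    have hbal : √(g / y) * √(g * y) = g := by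
      rw [← Real.sqrt_mul (div_pos hg hy).le, div_mul_eq_mul_div, mul_div_assoc,
        mul_div_assoc, div_self hy.ne', mul_one, Real.sqrt_mul_self hg.le]
    rw [Real.sq_sqrt (div_pos hg hy).le, div_mul_cancel₀ _ hy.ne'] at hx
    have : x < 2 * √(g * y) := lt_of_mul_lt_mul_left (by linarith) hl.le
    linarith

lemma HasBernsteinMoments.measure_lt_abs_sum_le [IsProbabilityMeasure P]
    (h : HasBernsteinMoments P ℱ T D v) {n : ℕ} (hn : n ≤ T) {F : Finset ℝ}
    (hF : ∀ ω, ∑ t ∈ Finset.range n, v t ω ∈ F) {g : ℝ} (hg : 0 < g) :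
    P {ω | 2 * √(g * ∑ t ∈ Finset.range n, v t ω) + 2 * g < |∑ t ∈ Finset.range n, D t ω|} ≤
      2 * F.card * ENNReal.ofReal (Real.exp (-g)) := by
  choose l hl hbound using exists_forall_le_two_mul_sqrt_add hg
  let E (l : ℝ) : Set Ω :=
    {ω | g ≤ l * ∑ t ∈ Finset.range n, D t ω - l ^ 2 * ∑ t ∈ Finset.range n, v t ω}
  have hE {l : ℝ} (hl : |l| ≤ 1) : P (E l) ≤ ENNReal.ofReal (Real.exp (-g)) :=
    h.measure_le_sum_le hl hn g
  have hsub : {ω | 2 * √(g * ∑ t ∈ Finset.range n, v t ω) + 2 * g <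
      |∑ t ∈ Finset.range n, D t ω|} ⊆ ⋃ y ∈ F, (E (l y) ∪ E (-l y)) := by
    intro ω hω
    refine Set.mem_biUnion (hF ω) ?_
    by_contra hnot
    obtain ⟨hpos, hneg⟩ := not_or.1 hnot
    refine (abs_le'.2 ⟨hbound _ _ (not_le.1 hpos), hbound _ _ ?_⟩).not_gt hω
    rw [← neg_sq, mul_neg, ← neg_mul]
    exact not_le.1 hneg
  calc P _ ≤ ∑ y ∈ F, P (E (l y) ∪ E (-l y)) :=
        (measure_mono hsub).trans (measure_biUnion_finset_le F _)
    _ ≤ ∑ _y ∈ F, 2 * ENNReal.ofReal (Real.exp (-g)) := by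
        gcongr with y
        rw [two_mul]
        exact (measure_union_le _ _).trans
          (add_le_add (hE (hl y)) (hE ((abs_neg (l y)).trans_le (hl y))))
    _ = 2 * F.card * ENNReal.ofReal (Real.exp (-g)) := by
        rw [Finset.sum_const, nsmul_eq_mul]
        ring

end Bernstein

section Concentration

variable {d m T : ℕ} {ν : Fin m → Measure (Fin d → ℝ)} {Ω : Type*} [mΩ : MeasurableSpace Ω]
  {P : Measure Ω} {ℱ : Filtration ℕ mΩ} {I : ℕ → Ω → Fin m} {V : ℕ → Ω → Fin d → ℝ}

lemma lintegral_eq_sum_setLIntegral_fiber {ι : Type*} [Fintype ι] [MeasurableSpace ι]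
    [MeasurableSingletonClass ι] (P : Measure Ω) {I : Ω → ι} (hI : Measurable I)
    (F : Ω → ENNReal) : ∫⁻ ω, F ω ∂P = ∑ i, ∫⁻ ω in {ω | I ω = i}, F ω ∂P := by
  conv_lhs => rw [← sum_restrict_fiber P hI, lintegral_finsetSum_measure]

namespace IsInteraction

lemma map_restrict_withDensity (h : IsInteraction T ν P ℱ I V) {t : ℕ} (ht : t < T) (i : Fin m)
    {W : Ω → ENNReal} (hW : Measurable[ℱ t] W) :
    ((P.withDensity W).restrict {ω | I t ω = i}).map (V t) =
      (∫⁻ ω in {ω | I t ω = i}, W ω ∂P) • ν i := by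
  ext B hB
  have hVB : MeasurableSet {ω | V t ω ∈ B} := h.measurable_obs ht hB
  have hi : MeasurableSet {ω | I t ω = i} := h.measurable_arm ht (measurableSet_singleton i)
  have hlaw (A : Set Ω) (hA : MeasurableSet[ℱ t] A) :
      P.restrict ({ω | I t ω = i} ∩ {ω | V t ω ∈ B}) A =
        (ν i B • P.restrict {ω | I t ω = i}) A := by
    rw [Measure.smul_apply, Measure.restrict_apply (ℱ.le t _ hA),
      Measure.restrict_apply (ℱ.le t _ hA), smul_eq_mul, mul_comm, ← h.obs_law t ht A hA i B hB,
      Set.inter_assoc]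
  calc ((P.withDensity W).restrict {ω | I t ω = i}).map (V t) B
      = ∫⁻ ω in {ω | I t ω = i} ∩ {ω | V t ω ∈ B}, W ω ∂P := by
        rw [Measure.map_apply (h.measurable_obs ht) hB,
          Measure.restrict_apply (h.measurable_obs ht hB), Set.inter_comm]
        exact withDensity_apply _ (hi.inter hVB)
    _ = (∫⁻ ω in {ω | I t ω = i}, W ω ∂P) * ν i B := by
        rw [lintegral_congr_of_forall_measurableSet (ℱ.le t) hlaw hW, lintegral_smul_measure,
          smul_eq_mul, mul_comm]

lemma setLIntegral_mul_comp_obs (h : IsInteraction T ν P ℱ I V) {t : ℕ} (ht : t < T) (i : Fin m)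
    {W : Ω → ENNReal} (hW : Measurable[ℱ t] W) {g : (Fin d → ℝ) → ENNReal} (hg : Measurable g) :
    ∫⁻ ω in {ω | I t ω = i}, W ω * g (V t ω) ∂P =
      (∫⁻ ω in {ω | I t ω = i}, W ω ∂P) * ∫⁻ v, g v ∂(ν i) := by
  rw [← smul_eq_mul, ← lintegral_smul_measure, ← h.map_restrict_withDensity ht i hW,
    lintegral_map hg (h.measurable_obs ht)]
  exact (setLIntegral_withDensity_eq_setLIntegral_mul P (hW.mono (ℱ.le t) le_rfl)
    (hg.comp (h.measurable_obs ht)) (h.measurable_arm ht (measurableSet_singleton i))).symm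

lemma hasBernsteinMoments_obs [∀ i, IsProbabilityMeasure (ν i)] (h : IsInteraction T ν P ℱ I V)
    (hcube : ∀ i, ∀ᵐ v ∂(ν i), v ∈ unitCube d) (j : Fin d) (i : Fin m) :
    HasBernsteinMoments P ℱ T
      (fun t ω => if I t ω = i then V t ω j - meanMatrix ν j i else 0)
      (fun t ω => if I t ω = i then meanMatrix ν j i else 0) where
  measurable t ht := .ite (h.arm_measurable t ht (measurableSet_singleton i))
    (((measurable_pi_apply j).comp (h.obs_measurable t ht)).sub_const _) measurable_const
  measurable_proxy t ht :=
    .ite (h.arm_measurable t ht (measurableSet_singleton i)) measurable_const measurable_const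
  lintegral_mul_exp_le t ht l hl W hW := by
    have hI := h.measurable_arm ht
    rw [lintegral_eq_sum_setLIntegral_fiber P hI, lintegral_eq_sum_setLIntegral_fiber P hI]
    refine Finset.sum_le_sum fun i' _ => ?_
    rcases eq_or_ne i' i with rfl | hi
    · calc _ = ∫⁻ ω in {ω | I t ω = i'}, W ω * ENNReal.ofReal
              (Real.exp (l * (V t ω j - meanMatrix ν j i') - l ^ 2 * meanMatrix ν j i')) ∂P :=
            setLIntegral_congr_fun (hI (measurableSet_singleton i')) fun ω hω => by
              simp only [show I t ω = i' from hω, if_true]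
        _ = (∫⁻ ω in {ω | I t ω = i'}, W ω ∂P) * ∫⁻ v, ENNReal.ofReal
              (Real.exp (l * (v j - meanMatrix ν j i') - l ^ 2 * meanMatrix ν j i')) ∂(ν i') :=
            h.setLIntegral_mul_comp_obs ht i' hW (g := fun v => ENNReal.ofReal
              (Real.exp (l * (v j - meanMatrix ν j i') - l ^ 2 * meanMatrix ν j i')))
              (by fun_prop)
        _ ≤ ∫⁻ ω in {ω | I t ω = i'}, W ω ∂P := mul_le_of_le_one_right'
            (lintegral_exp_mul_sub_integral_le_one (measurable_pi_apply j).aemeasurable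
              ((hcube i').mono fun v hv => ⟨hv.1 j, hv.2 j⟩) hl)
    · refine (setLIntegral_congr_fun (hI (measurableSet_singleton i')) fun ω hω => ?_).le
      simp [show I t ω = i' from hω, hi]

end IsInteraction

namespace IsDualRun

variable {γ : ℝ} {f : (Fin d → ℝ) → ℝ} {K : Set (Fin d → ℝ)} {Ξ : Type*} {oco : OCOMethod K Ξ}
  {ξ : Ω → Ξ} {θ : ℕ → Ω → Fin d → ℝ} {p : ℕ → Ω → Fin m → ℝ}
  {est : ℕ → Ω → Matrix (Fin d) (Fin m) ℝ}

lemma setLIntegral_arm (h : IsDualRun T ν γ f oco P ℱ ξ θ p est I V) {t : ℕ} (ht : t < T)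
    (i : Fin m) {W : Ω → ENNReal} (hW : Measurable[ℱ t] W) :
    ∫⁻ ω in {ω | I t ω = i}, W ω ∂P = ∫⁻ ω, ENNReal.ofReal (p t ω i) * W ω ∂P := by
  have hp : Measurable fun ω => ENNReal.ofReal (p t ω i) :=
    (((measurable_pi_apply i).comp (h.prob_measurable t ht)).mono (ℱ.le t) le_rfl).ennreal_ofReal
  have hlaw (A : Set Ω) (hA : MeasurableSet[ℱ t] A) :
      P.restrict {ω | I t ω = i} A = P.withDensity (fun ω => ENNReal.ofReal (p t ω i)) A := by
    rw [Measure.restrict_apply (ℱ.le t _ hA), withDensity_apply _ (ℱ.le t _ hA),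
      h.arm_law t ht A hA i]
  rw [lintegral_congr_of_forall_measurableSet (ℱ.le t) hlaw hW,
    lintegral_withDensity_eq_lintegral_mul _ hp (hW.mono (ℱ.le t) le_rfl)]
  rfl

lemma lintegral_comp_arm (h : IsDualRun T ν γ f oco P ℱ ξ θ p est I V) {t : ℕ} (ht : t < T)
    {G : Ω → Fin m → ENNReal} (hG : ∀ i, Measurable[ℱ t] fun ω => G ω i) :
    ∫⁻ ω, G ω (I t ω) ∂P = ∫⁻ ω, ∑ i, ENNReal.ofReal (p t ω i) * G ω i ∂P := by
  have hI := h.interaction.measurable_arm ht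
  have hpG (i : Fin m) : Measurable fun ω => ENNReal.ofReal (p t ω i) * G ω i :=
    (((measurable_pi_apply i).comp (h.prob_measurable t ht)).ennreal_ofReal.mul (hG i)).mono
      (ℱ.le t) le_rfl
  rw [lintegral_eq_sum_setLIntegral_fiber P hI, lintegral_finsetSum _ fun i _ => hpG i]
  refine Finset.sum_congr rfl fun i _ => ?_
  rw [← h.setLIntegral_arm ht i (hG i)]
  exact setLIntegral_congr_fun (hI (measurableSet_singleton i)) fun ω hω =>
    congrArg (G ω) hω

lemma measurable_dotProduct (h : IsDualRun T ν γ f oco P ℱ ξ θ p est I V) {t : ℕ} (ht : t < T)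
    {a : Ω → Fin m → ℝ} (ha : Measurable[ℱ t] a) : Measurable[ℱ t] fun ω => p t ω ⬝ᵥ a ω :=
  Finset.measurable_fun_sum _ fun i _ =>
    ((measurable_pi_apply i).comp (h.prob_measurable t ht)).mul ((measurable_pi_apply i).comp ha)

lemma hasBernsteinMoments_arm (h : IsDualRun T ν γ f oco P ℱ ξ θ p est I V)
    {a : ℕ → Ω → Fin m → ℝ} (ha : ∀ t < T, Measurable[ℱ t] (a t))
    (ha01 : ∀ t < T, ∀ ω i, a t ω i ∈ Set.Icc (0 : ℝ) 1) :
    HasBernsteinMoments P ℱ T (fun t ω => a t ω (I t ω) - p t ω ⬝ᵥ a t ω) (fun _ _ => 1) where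
  measurable t ht := by
    have heval : Measurable fun z : (Fin m → ℝ) × Fin m => z.1 z.2 :=
      measurable_from_prod_countable_left measurable_pi_apply
    have hle := ℱ.mono t.le_succ
    exact (heval.comp (((ha t ht).mono hle le_rfl).prodMk
      (h.interaction.arm_measurable t ht))).sub
        ((h.measurable_dotProduct ht (ha t ht)).mono hle le_rfl)
  measurable_proxy _ _ := measurable_const
  lintegral_mul_exp_le t ht l hl W hW := by
    have hexp (i : Fin m) : Measurable[ℱ t] fun ω =>
        W ω * ENNReal.ofReal (Real.exp (l * (a t ω i - p t ω ⬝ᵥ a t ω) - l ^ 2)) :=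
      hW.mul ((((measurable_pi_apply i).comp (ha t ht)).sub
        (h.measurable_dotProduct ht (ha t ht))).const_mul l |>.sub_const _).exp.ennreal_ofReal
    simp only [mul_one]
    rw [h.lintegral_comp_arm ht (G := fun ω i =>
      W ω * ENNReal.ofReal (Real.exp (l * (a t ω i - p t ω ⬝ᵥ a t ω) - l ^ 2))) hexp]
    gcongr with ω
    calc _ = W ω * ENNReal.ofReal
          (∑ i, p t ω i * Real.exp (l * (a t ω i - p t ω ⬝ᵥ a t ω) - l ^ 2)) := by
          rw [ENNReal.ofReal_sum_of_nonneg fun i _ =>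
            mul_nonneg ((h.prob_mem t ht ω).1 i) (Real.exp_pos _).le, Finset.mul_sum]
          refine Finset.sum_congr rfl fun i _ => ?_
          rw [ENNReal.ofReal_mul ((h.prob_mem t ht ω).1 i)]
          ring
      _ ≤ W ω := mul_le_of_le_one_right'
          (ENNReal.ofReal_le_one.2 (sum_mul_exp_le_one (h.prob_mem t ht ω) (ha01 t ht ω) hl))

end IsDualRun

end Concentration

section Confidence

-- The bound is self-improving: `√(g y) ≤ √(g S) + √(g |S - y|)`, and the last term is absorbed.
lemma abs_sub_le_of_abs_sub_le_sqrt {g S y : ℝ} (hg : 0 ≤ g) (hS : 0 ≤ S)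
    (h : |S - y| ≤ 2 * √(g * y) + 2 * g) : |S - y| ≤ 4 * √(g * S) + 8 * g := by
  have hD : 0 ≤ |S - y| := abs_nonneg _
  have hsub : √(g * y) ≤ √(g * S) + √(g * |S - y|) := by
    have hS' := Real.sq_sqrt (mul_nonneg hg hS)
    have hD' := Real.sq_sqrt (mul_nonneg hg hD)
    have hy : y ≤ S + |S - y| := by linarith [neg_abs_le (S - y)]
    refine Real.sqrt_le_iff.2 ⟨by positivity, ?_⟩
    linarith [mul_le_mul_of_nonneg_left hy hg,
      mul_nonneg (Real.sqrt_nonneg (g * S)) (Real.sqrt_nonneg (g * |S - y|))]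
  have hamgm : √(g * |S - y|) ≤ g + |S - y| / 4 := by
    refine Real.sqrt_le_iff.2 ⟨by positivity, ?_⟩
    linarith [sq_nonneg (g - |S - y| / 4)]
  linarith

lemma sqrt_div_eq_sqrt_mul_div (x : ℝ) {N : ℝ} (hN : 0 < N) : √(x / N) = √(x * N) / N := by
  rw [← mul_div_mul_right x N hN.ne', Real.sqrt_div' _ (mul_self_nonneg N),
    Real.sqrt_mul_self hN.le]

lemma rad_div_eq (γ S : ℝ) {N : ℝ} (hN : 0 < N) : rad γ (S / N) N = (√(γ * S) + γ) / N := by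
  rw [rad, sqrt_div_eq_sqrt_mul_div _ hN, mul_assoc, div_mul_cancel₀ _ hN.ne', add_div]

lemma sqrt_sixteen_mul (x : ℝ) : √(16 * x) = 4 * √x := by
  rw [Real.sqrt_mul (by norm_num), show (16 : ℝ) = 4 ^ 2 by norm_num,
    Real.sqrt_sq (by norm_num)]

lemma abs_div_sub_le_two_mul_rad {g S k μ : ℝ} (hg : 1 ≤ 8 * g) (hS : 0 ≤ S) (hk : 0 ≤ k)
    (hμ : μ ∈ Set.Icc (0 : ℝ) 1) (h : |S - k * μ| ≤ 2 * √(g * (k * μ)) + 2 * g) :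
    |S / (k + 1) - μ| ≤ 2 * rad (16 * g) (S / (k + 1)) (k + 1) := by
  have hN : 0 < k + 1 := by linarith
  have hdev := abs_sub_le_of_abs_sub_le_sqrt (by linarith) hS h
  calc |S / (k + 1) - μ| = |(S - k * μ) - μ| / (k + 1) := by
        rw [div_sub' hN.ne', abs_div, abs_of_pos hN]
        ring_nf
    _ ≤ 2 * ((4 * √(g * S) + 16 * g) / (k + 1)) := by
        rw [← mul_div_assoc]
        gcongr
        have := abs_sub (S - k * μ) μ
        rw [abs_of_nonneg hμ.1] at this
        linarith [hμ.2, Real.sqrt_nonneg (g * S)]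
    _ = 2 * rad (16 * g) (S / (k + 1)) (k + 1) := by
        rw [rad_div_eq _ _ hN, mul_assoc, sqrt_sixteen_mul]

lemma rad_le_two_mul_sqrt {γ x N : ℝ} (hx : x ≤ 1)
    (h : γ / N ∈ Set.Icc (0 : ℝ) 1) : rad γ x N ≤ 2 * √(γ / N) := by
  have hsqrt : √(γ * x / N) ≤ √(γ / N) := by
    rw [mul_div_right_comm]
    exact Real.sqrt_le_sqrt (mul_le_of_le_one_right h.1 hx)
  have hdiv : γ / N ≤ √(γ / N) := Real.le_sqrt_of_sq_le (pow_le_of_le_one h.1 h.2 two_ne_zero)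
  rw [rad]
  linarith

variable {d m : ℕ} {I : ℕ → Fin m} {V : ℕ → Fin d → ℝ} {γ : ℝ} {t : ℕ}
  {A B : Matrix (Fin d) (Fin m) ℝ}

lemma mem_Icc_of_mem_confBox (hA : A ∈ confBox γ I V t) (j : Fin d) (i : Fin m) :
    A j i ∈ Set.Icc (0 : ℝ) 1 :=
  ⟨(le_max_left _ _).trans (hA j i).1, (hA j i).2.trans (min_le_left _ _)⟩

lemma abs_sub_le_of_mem_confBox (hγ : 0 ≤ γ) {j : Fin d} {i : Fin m}
    (hmean : empMean I V t j i ≤ 1) (hA : A ∈ confBox γ I V t) (hB : B ∈ confBox γ I V t) :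
    |A j i - B j i| ≤ 8 * √(γ / (plays I t i + 1)) := by
  have hN : (0 : ℝ) ≤ plays I t i + 1 := by positivity
  rcases le_total (γ / (plays I t i + 1)) 1 with h | h
  · have hrad := rad_le_two_mul_sqrt hmean ⟨div_nonneg hγ hN, h⟩
    obtain ⟨⟨-, hA₁⟩, -, hA₂⟩ := (hA j i).imp max_le_iff.1 le_min_iff.1
    obtain ⟨⟨-, hB₁⟩, -, hB₂⟩ := (hB j i).imp max_le_iff.1 le_min_iff.1
    exact abs_le.2 ⟨by linarith, by linarith⟩
  · obtain ⟨hA₁, hA₂⟩ := mem_Icc_of_mem_confBox hA j i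
    obtain ⟨hB₁, hB₂⟩ := mem_Icc_of_mem_confBox hB j i
    have := Real.one_le_sqrt.2 h
    exact abs_le.2 ⟨by linarith, by linarith⟩

end Confidence

section Plays

variable {m : ℕ} (I : ℕ → Fin m) (t : ℕ)

lemma plays_succ (i : Fin m) : plays I (t + 1) i = plays I t i + if I t = i then 1 else 0 := by
  simp only [plays, Finset.card_filter, Finset.sum_range_succ]

lemma plays_le (i : Fin m) : plays I t i ≤ t :=
  (Finset.card_filter_le _ _).trans_eq (Finset.card_range t)

lemma sum_plays : ∑ i, plays I t i = t :=
  (Finset.card_eq_sum_card_fiberwise fun _ _ => Finset.mem_coe.2 (Finset.mem_univ _)).symm.trans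
    (Finset.card_range t)

lemma sum_comp_plays (φ : ℕ → ℝ) :
    ∑ s ∈ Finset.range t, φ (plays I s (I s)) = ∑ i, ∑ k ∈ Finset.range (plays I t i), φ k := by
  induction t with
  | zero => simp [plays]
  | succ t ih =>
    have hsucc (i : Fin m) : ∑ k ∈ Finset.range (plays I (t + 1) i), φ k =
        ∑ k ∈ Finset.range (plays I t i), φ k + if I t = i then φ (plays I t i) else 0 := by
      rw [plays_succ]
      split_ifs
      · rw [Finset.sum_range_succ]
      · rw [add_zero, add_zero]
    simp only [hsucc, Finset.sum_range_succ, ih, Finset.sum_add_distrib, Finset.sum_ite_eq,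
      Finset.mem_univ, if_true]

lemma sum_sqrt_plays_le : ∑ i, √(plays I t i) ≤ √(m * t) := by
  have hcs := sq_sum_le_card_mul_sum_sq (s := Finset.univ) (f := fun i => √(plays I t i : ℝ))
  simp only [Real.sq_sqrt (Nat.cast_nonneg _), Finset.card_univ, Fintype.card_fin] at hcs
  rw [← Nat.cast_sum, sum_plays] at hcs
  exact Real.le_sqrt_of_sq_le hcs

lemma sum_one_div_sqrt_succ_le (n : ℕ) :
    ∑ k ∈ Finset.range n, 1 / √((k : ℝ) + 1) ≤ 2 * √n := by
  induction n with
  | zero => simp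
  | succ n ih =>
    have hpos : 0 < √((n : ℝ) + 1) := Real.sqrt_pos.2 (by positivity)
    have hstep : 1 / √((n : ℝ) + 1) ≤ 2 * (√((n : ℝ) + 1) - √n) := by
      rw [div_le_iff₀ hpos]
      linarith [sq_nonneg (√((n : ℝ) + 1) - √n), Real.sq_sqrt (Nat.cast_nonneg (α := ℝ) n),
        Real.sq_sqrt (show (0 : ℝ) ≤ n + 1 by positivity)]
    rw [Finset.sum_range_succ, Nat.cast_succ]
    linarith

lemma sum_one_div_sqrt_plays_le :
    ∑ s ∈ Finset.range t, 1 / √((plays I s (I s) : ℝ) + 1) ≤ 2 * √(m * t) :=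
  calc _ = ∑ i, ∑ k ∈ Finset.range (plays I t i), 1 / √((k : ℝ) + 1) :=
        sum_comp_plays I t fun k => 1 / √((k : ℝ) + 1)
    _ ≤ ∑ i, 2 * √(plays I t i) := Finset.sum_le_sum fun i _ => sum_one_div_sqrt_succ_le _
    _ ≤ 2 * √(m * t) := by
        rw [← Finset.mul_sum]
        gcongr
        exact sum_sqrt_plays_le I t

end Plays

section Typical

variable {d m T : ℕ}

/-- The sum of component `j` of the observations made from arm `i` before round `t`. -/
def obsSum (I : ℕ → Fin m) (V : ℕ → Fin d → ℝ) (t : ℕ) (j : Fin d) (i : Fin m) : ℝ :=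
  ∑ s ∈ Finset.range t with I s = i, V s j

/-- The realizations on which the regret bound holds: up to deviations of Bernstein type at level
`g`, all sums of observations are close to their means `plays I t i * M j i`, and drawing the arms
`I t` from `p t` changes little in the sum of the estimates `A t`. -/
structure IsTypical (g : ℝ) (T : ℕ) (M : Matrix (Fin d) (Fin m) ℝ)
    (A : ℕ → Matrix (Fin d) (Fin m) ℝ) (p : ℕ → Fin m → ℝ) (I : ℕ → Fin m)
    (V : ℕ → Fin d → ℝ) : Prop where
  obs : ∀ t ≤ T, ∀ j i, |obsSum I V t j i - plays I t i * M j i| ≤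
    2 * √(g * (plays I t i * M j i)) + 2 * g
  arm : ∀ j, |∑ t ∈ Finset.range T, (A t j (I t) - p t ⬝ᵥ A t j)| ≤ 2 * √(g * T) + 2 * g

variable {I : ℕ → Fin m} {V : ℕ → Fin d → ℝ} {M : Matrix (Fin d) (Fin m) ℝ}
  {A : ℕ → Matrix (Fin d) (Fin m) ℝ} {p : ℕ → Fin m → ℝ} {γ g : ℝ}

lemma obsSum_nonneg {t : ℕ} (hV : ∀ s < t, V s ∈ unitCube d) (j : Fin d) (i : Fin m) :
    0 ≤ obsSum I V t j i :=
  Finset.sum_nonneg fun s hs => (hV s (Finset.mem_range.1 (Finset.mem_filter.1 hs).1)).1 j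

lemma empMean_le_one {t : ℕ} (hV : ∀ s < t, V s ∈ unitCube d) (j : Fin d) (i : Fin m) :
    empMean I V t j i ≤ 1 := by
  have hle : obsSum I V t j i ≤ plays I t i :=
    (Finset.sum_le_card_nsmul _ _ 1 fun s hs =>
      (hV s (Finset.mem_range.1 (Finset.mem_filter.1 hs).1)).2 j).trans_eq (nsmul_one _)
  exact div_le_one_of_le₀ (hle.trans (by linarith)) (by positivity)

lemma IsTypical.mem_confBox (h : IsTypical g T M A p I V) (hV : ∀ t < T, V t ∈ unitCube d)
    (hM : ∀ j i, M j i ∈ Set.Icc (0 : ℝ) 1) (hg : 1 ≤ 8 * g) {t : ℕ} (ht : t ≤ T) :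
    M ∈ confBox (16 * g) I V t := by
  intro j i
  have hdev : |empMean I V t j i - M j i| ≤
      2 * rad (16 * g) (empMean I V t j i) (plays I t i + 1) :=
    abs_div_sub_le_two_mul_rad hg (obsSum_nonneg (fun s hs => hV s (hs.trans_le ht)) j i)
      (Nat.cast_nonneg _) (hM j i) (h.obs t ht j i)
  rw [abs_le] at hdev
  exact ⟨max_le (hM j i).1 (by linarith), le_min (hM j i).2 (by linarith)⟩

lemma sum_abs_sub_le_of_mem_confBox (hV : ∀ t < T, V t ∈ unitCube d) (hγ : 0 ≤ γ)
    (hA : ∀ t < T, A t ∈ confBox γ I V t) (hM : ∀ t < T, M ∈ confBox γ I V t) (j : Fin d) :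
    ∑ t ∈ Finset.range T, |A t j (I t) - M j (I t)| ≤ 16 * √(γ * (m * T)) := by
  have hterm (t : ℕ) (ht : t < T) :
      |A t j (I t) - M j (I t)| ≤ 8 * √γ * (1 / √((plays I t (I t) : ℝ) + 1)) := by
    rw [mul_assoc, mul_one_div, ← Real.sqrt_div hγ]
    exact abs_sub_le_of_mem_confBox hγ (empMean_le_one (fun s hs => hV s (hs.trans ht)) j (I t))
      (hA t ht) (hM t ht)
  calc _ ≤ ∑ t ∈ Finset.range T, 8 * √γ * (1 / √((plays I t (I t) : ℝ) + 1)) :=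
        Finset.sum_le_sum fun t ht => hterm t (Finset.mem_range.1 ht)
    _ ≤ 8 * √γ * (2 * √(m * T)) := by
        rw [← Finset.mul_sum]
        gcongr
        exact sum_one_div_sqrt_plays_le I T
    _ = 16 * √(γ * (m * T)) := by
        rw [Real.sqrt_mul hγ]
        ring

lemma sum_filter_sub_eq_obsSum_sub (t : ℕ) (j : Fin d) (i : Fin m) (c : ℝ) :
    ∑ s ∈ Finset.range t with I s = i, (V s j - c) = obsSum I V t j i - plays I t i * c := by
  rw [Finset.sum_sub_distrib, Finset.sum_const, nsmul_eq_mul, plays, obsSum]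

lemma sum_sub_eq_sum_obsSum_sub (j : Fin d) :
    ∑ t ∈ Finset.range T, (V t j - M j (I t)) =
      ∑ i, (obsSum I V T j i - plays I T i * M j i) := by
  rw [← Finset.sum_fiberwise (Finset.range T) I]
  refine Finset.sum_congr rfl fun i _ => ?_
  rw [← sum_filter_sub_eq_obsSum_sub]
  exact Finset.sum_congr rfl fun t ht => by rw [(Finset.mem_filter.1 ht).2]

lemma IsTypical.abs_sum_obs_sub_le (h : IsTypical g T M A p I V)
    (hM : ∀ j i, M j i ∈ Set.Icc (0 : ℝ) 1) (hg : 0 ≤ g) (j : Fin d) :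
    |∑ t ∈ Finset.range T, (V t j - M j (I t))| ≤ 2 * √(g * (m * T)) + 2 * (g * m) := by
  have hterm (i : Fin m) :
      |obsSum I V T j i - plays I T i * M j i| ≤ 2 * √g * √(plays I T i) + 2 * g := by
    refine (h.obs T le_rfl j i).trans ?_
    rw [mul_assoc, ← Real.sqrt_mul hg]
    gcongr
    exact mul_le_of_le_one_right (Nat.cast_nonneg _) (hM j i).2
  rw [sum_sub_eq_sum_obsSum_sub]
  calc _ ≤ ∑ i, (2 * √g * √(plays I T i) + 2 * g) :=
        (Finset.abs_sum_le_sum_abs _ _).trans (Finset.sum_le_sum fun i _ => hterm i)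
    _ = 2 * √g * ∑ i, √(plays I T i) + 2 * (g * m) := by
        rw [Finset.sum_add_distrib, ← Finset.mul_sum, Fin.sum_const, nsmul_eq_mul]
        ring
    _ ≤ 2 * √(g * (m * T)) + 2 * (g * m) := by
        rw [Real.sqrt_mul hg, ← mul_assoc 2 √g]
        gcongr 2 * √g * ?_ + _
        exact sum_sqrt_plays_le I T

lemma IsTypical.abs_sum_est_sub_obs_le (h : IsTypical g T M A p I V) (hm : 0 < m)
    (hV : ∀ t < T, V t ∈ unitCube d) (hM : ∀ j i, M j i ∈ Set.Icc (0 : ℝ) 1) (hg : 1 ≤ 8 * g)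
    (hA : ∀ t < T, A t ∈ confBox (16 * g) I V t) (hgT : 16 * g * m ≤ T) (j : Fin d) :
    |∑ t ∈ Finset.range T, ((A t *ᵥ p t) j - V t j)| ≤ 18 * √(16 * g * (m * T)) := by
  have hg₀ : 0 ≤ g := by linarith
  have hm₁ : (1 : ℝ) ≤ m := by exact_mod_cast hm
  have hsplit : ∑ t ∈ Finset.range T, ((A t *ᵥ p t) j - V t j) =
      ∑ t ∈ Finset.range T, (A t j (I t) - M j (I t)) -
        ∑ t ∈ Finset.range T, (A t j (I t) - p t ⬝ᵥ A t j) -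
        ∑ t ∈ Finset.range T, (V t j - M j (I t)) := by
    simp only [← Finset.sum_sub_distrib, mulVec, dotProduct_comm (A _ j)]
    exact Finset.sum_congr rfl fun t _ => by ring
  set R := √(16 * g * (m * T)) with hR
  have hquarter : √(g * (m * T)) = R / 4 := by
    rw [hR, mul_assoc, sqrt_sixteen_mul]
    ring
  have hest : |∑ t ∈ Finset.range T, (A t j (I t) - M j (I t))| ≤ 16 * R :=
    (Finset.abs_sum_le_sum_abs _ _).trans
      (sum_abs_sub_le_of_mem_confBox hV (by linarith) hA
        (fun t ht => h.mem_confBox hV hM hg ht.le) j)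
  have harm : |∑ t ∈ Finset.range T, (A t j (I t) - p t ⬝ᵥ A t j)| ≤ R / 2 + 2 * (g * m) := by
    have hsqrt : √(g * T) ≤ R / 4 := by
      rw [← hquarter]
      gcongr
      exact le_mul_of_one_le_left T.cast_nonneg hm₁
    linarith [h.arm j, le_mul_of_one_le_right hg₀ hm₁]
  have hobs := h.abs_sum_obs_sub_le hM hg₀ j
  have hgm : 16 * (g * m) ≤ R := by
    refine Real.le_sqrt_of_sq_le ?_
    nlinarith [mul_nonneg hg₀ m.cast_nonneg (α := ℝ)]
  rw [hquarter] at hobs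
  rw [hsplit]
  refine (abs_sub _ _).trans ((add_le_add_left (abs_sub _ _) _).trans ?_)
  linarith [Real.sqrt_nonneg (16 * g * (m * T))]

lemma IsTypical.abs_avgObs_sub_le (h : IsTypical g T M A p I V) (hT : 0 < T) (hm : 0 < m)
    (hV : ∀ t < T, V t ∈ unitCube d) (hM : ∀ j i, M j i ∈ Set.Icc (0 : ℝ) 1) (hg : 1 ≤ 8 * g)
    (hA : ∀ t < T, A t ∈ confBox (16 * g) I V t) (hp : ∀ t < T, p t ∈ stdSimplex ℝ (Fin m))
    (j : Fin d) :
    |avgObs T (fun t => A t *ᵥ p t) j - avgObs T V j| ≤ 18 * √(16 * g * m / T) := by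
  have hT' : (0 : ℝ) < T := by exact_mod_cast hT
  rcases le_total (T : ℝ) (16 * g * m) with hbig | hsmall
  · have hx : avgObs T (fun t => A t *ᵥ p t) ∈ unitCube d :=
      avgObs_mem hT (convex_Icc 0 1) fun t ht =>
        mulVec_mem_unitCube (mem_Icc_of_mem_confBox (hA t ht)) (hp t ht)
    have hv : avgObs T V ∈ unitCube d := avgObs_mem hT (convex_Icc 0 1) hV
    have hone : 1 ≤ √(16 * g * m / T) := Real.one_le_sqrt.2 ((one_le_div hT').2 hbig)
    have hle : |avgObs T (fun t => A t *ᵥ p t) j - avgObs T V j| ≤ 1 :=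
      abs_sub_le_of_nonneg_of_le (hx.1 j) (hx.2 j) (hv.1 j) (hv.2 j)
    linarith
  · have hdiff : avgObs T (fun t => A t *ᵥ p t) j - avgObs T V j =
        (∑ t ∈ Finset.range T, ((A t *ᵥ p t) j - V t j)) / T := by
      simp only [avgObs, Pi.smul_apply, Finset.sum_apply, smul_eq_mul, Finset.sum_sub_distrib]
      ring
    rw [hdiff, abs_div, abs_of_pos hT', sqrt_div_eq_sqrt_mul_div _ hT', mul_assoc (16 * g),
      ← mul_div_assoc]
    gcongr
    exact h.abs_sum_est_sub_obs_le hm hV hM hg hA hsmall j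

end Typical

section Probability

variable {d m T : ℕ} {ν : Fin m → Measure (Fin d → ℝ)} {Ω : Type*} [mΩ : MeasurableSpace Ω]
  {P : Measure Ω} [IsProbabilityMeasure P] {ℱ : Filtration ℕ mΩ} {I : ℕ → Ω → Fin m}
  {V : ℕ → Ω → Fin d → ℝ} {g : ℝ}

lemma IsInteraction.measure_obsSum_deviation_le [∀ i, IsProbabilityMeasure (ν i)]
    (h : IsInteraction T ν P ℱ I V) (hcube : ∀ i, ∀ᵐ v ∂(ν i), v ∈ unitCube d) (hg : 0 < g)
    {t : ℕ} (ht : t ≤ T) (j : Fin d) (i : Fin m) :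
    P {ω | 2 * √(g * (plays (I · ω) t i * meanMatrix ν j i)) + 2 * g <
        |obsSum (I · ω) (V · ω) t j i - plays (I · ω) t i * meanMatrix ν j i|} ≤
      2 * (T + 1) * ENNReal.ofReal (Real.exp (-g)) := by
  let F := (Finset.range (T + 1)).image fun n : ℕ => n * meanMatrix ν j i
  have hproxy (ω : Ω) : (∑ s ∈ Finset.range t, if I s ω = i then meanMatrix ν j i else 0) =
      plays (I · ω) t i * meanMatrix ν j i := by
    rw [← Finset.sum_filter, Finset.sum_const, nsmul_eq_mul, plays]
  have hF (ω : Ω) : (∑ s ∈ Finset.range t, if I s ω = i then meanMatrix ν j i else 0) ∈ F := by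
    rw [hproxy]
    exact Finset.mem_image_of_mem _
      (Finset.mem_range.2 (Nat.lt_succ_of_le ((plays_le (I · ω) t i).trans ht)))
  have hcard : (F.card : ENNReal) ≤ T + 1 := by
    exact_mod_cast Finset.card_image_le.trans_eq (Finset.card_range (T + 1))
  have htail := (h.hasBernsteinMoments_obs hcube j i).measure_lt_abs_sum_le ht hF hg
  simp only [hproxy, ← Finset.sum_filter,
    sum_filter_sub_eq_obsSum_sub (I := (I · _)) (V := (V · _))] at htail
  exact htail.trans (by gcongr)

variable {γ : ℝ} {f : (Fin d → ℝ) → ℝ} {K : Set (Fin d → ℝ)} {Ξ : Type*} {oco : OCOMethod K Ξ}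
  {ξ : Ω → Ξ} {θ : ℕ → Ω → Fin d → ℝ} {p : ℕ → Ω → Fin m → ℝ}
  {est : ℕ → Ω → Matrix (Fin d) (Fin m) ℝ}

lemma IsDualRun.measure_est_deviation_le (h : IsDualRun T ν γ f oco P ℱ ξ θ p est I V)
    (hg : 0 < g) (j : Fin d) :
    P {ω | 2 * √(g * T) + 2 * g <
        |∑ t ∈ Finset.range T, (est t ω j (I t ω) - p t ω ⬝ᵥ est t ω j)|} ≤
      2 * ENNReal.ofReal (Real.exp (-g)) := by
  have htail := (h.hasBernsteinMoments_arm (a := fun t ω => est t ω j)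
    (fun t ht => @measurable_pi_lambda _ _ _ (ℱ t) _ _ (h.est_measurable t ht j))
    fun t ht ω => mem_Icc_of_mem_confBox (h.est_mem t ht ω) j).measure_lt_abs_sum_le le_rfl
    (F := {(T : ℝ)}) (by simp) hg
  simpa using htail

lemma IsDualRun.measure_not_isTypical_le [∀ i, IsProbabilityMeasure (ν i)]
    (h : IsDualRun T ν γ f oco P ℱ ξ θ p est I V)
    (hcube : ∀ i, ∀ᵐ v ∂(ν i), v ∈ unitCube d) (hg : 0 < g) :
    P {ω | ¬ IsTypical g T (meanMatrix ν) (est · ω) (p · ω) (I · ω) (V · ω)} ≤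
      (2 * (T + 1) ^ 2 * (d * m) + 2 * d) * ENNReal.ofReal (Real.exp (-g)) := by
  let B (k : Fin (T + 1) × Fin d × Fin m) : Set Ω :=
    {ω | 2 * √(g * (plays (I · ω) k.1 k.2.2 * meanMatrix ν k.2.1 k.2.2)) + 2 * g <
      |obsSum (I · ω) (V · ω) k.1 k.2.1 k.2.2 -
        plays (I · ω) k.1 k.2.2 * meanMatrix ν k.2.1 k.2.2|}
  let C (j : Fin d) : Set Ω := {ω | 2 * √(g * T) + 2 * g <
    |∑ t ∈ Finset.range T, (est t ω j (I t ω) - p t ω ⬝ᵥ est t ω j)|}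
  have hsub : {ω | ¬ IsTypical g T (meanMatrix ν) (est · ω) (p · ω) (I · ω) (V · ω)} ⊆
      (⋃ k, B k) ∪ ⋃ j, C j := by
    intro ω hω
    by_contra hnot
    rw [Set.mem_union, Set.mem_iUnion, Set.mem_iUnion, not_or, not_exists, not_exists] at hnot
    exact hω ⟨fun t ht j i => not_lt.1 (hnot.1 (⟨t, Nat.lt_succ_of_le ht⟩, j, i)),
      fun j => not_lt.1 (hnot.2 j)⟩
  calc _ ≤ P (⋃ k, B k) + P (⋃ j, C j) := (measure_mono hsub).trans (measure_union_le _ _)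
    _ ≤ ∑ k, P (B k) + ∑ j, P (C j) :=
        add_le_add (measure_iUnion_fintype_le P B) (measure_iUnion_fintype_le P C)
    _ ≤ ∑ _k : Fin (T + 1) × Fin d × Fin m, 2 * (T + 1) * ENNReal.ofReal (Real.exp (-g)) +
          ∑ _j : Fin d, 2 * ENNReal.ofReal (Real.exp (-g)) :=
        add_le_add (Finset.sum_le_sum fun k _ => h.interaction.measure_obsSum_deviation_le hcube hg
          (Nat.le_of_lt_succ k.1.2) k.2.1 k.2.2)
          (Finset.sum_le_sum fun j _ => h.measure_est_deviation_le hg j)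
    _ = (2 * (T + 1) ^ 2 * (d * m) + 2 * d) * ENNReal.ofReal (Real.exp (-g)) := by
        simp only [Finset.sum_const, Finset.card_univ, Fintype.card_prod, Fintype.card_fin,
          nsmul_eq_mul, Nat.cast_mul, Nat.cast_add, Nat.cast_one]
        ring

lemma log_two_le_log_div {Q δ : ℝ} (hQ : 2 ≤ Q) (hδ : 0 < δ) (hδ₁ : δ < 1) :
    Real.log 2 ≤ Real.log (Q / δ) :=
  Real.log_le_log two_pos ((le_div_iff₀ hδ).2 (by linarith))

lemma mul_exp_neg_le {Q δ g : ℝ} (hQ : 2 ≤ Q) (hδ : 0 < δ) (hδ₁ : δ < 1)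
    (hg : 6 * Real.log (Q / δ) ≤ g) : 10 * Q ^ 2 * Real.exp (-g) ≤ δ := by
  have hQ₀ : 0 < Q := by linarith
  have hexp : Real.exp (-g) ≤ (δ / Q) ^ 6 := by
    rw [← Real.exp_log (pow_pos (div_pos hδ hQ₀) 6), Real.log_pow, ← inv_div, Real.log_inv]
    gcongr
    push_cast
    linarith
  have hhalf : δ / Q ≤ 1 / 2 := (div_le_div_iff₀ hQ₀ two_pos).2 (by linarith)
  calc 10 * Q ^ 2 * Real.exp (-g) ≤ 10 * Q ^ 2 * (δ / Q) ^ 6 := by gcongr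
    _ = 10 * δ * (δ / Q) ^ 4 * δ := by field_simp
    _ ≤ 10 * 1 * (1 / 2) ^ 4 * δ := by gcongr
    _ ≤ δ := by linarith

lemma pos_of_two_le_mul_mul (hQ : 2 ≤ m * T * d) : 0 < m ∧ 0 < T ∧ 0 < d := by
  simpa only [CanonicallyOrderedAdd.mul_pos, and_assoc] using two_pos.trans_le hQ

lemma two_mul_succ_sq_mul_add_le (hQ : 2 ≤ m * T * d) :
    2 * (T + 1) ^ 2 * (d * m) + 2 * d ≤ 10 * (m * T * d) ^ 2 := by
  obtain ⟨hm, hT, _⟩ := pos_of_two_le_mul_mul hQ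
  have hsucc : T + 1 ≤ 2 * T := by lia
  calc 2 * (T + 1) ^ 2 * (d * m) + 2 * d
      ≤ 2 * (2 * T) ^ 2 * (d * m) + 2 * (d * m * T ^ 2) := by
        gcongr
        rw [mul_assoc]
        exact Nat.le_mul_of_pos_right d (by positivity)
    _ = 10 * (T ^ 2 * (d * m)) := by ring
    _ ≤ 10 * (T ^ 2 * (d * m) ^ 2) := by
        gcongr
        exact Nat.le_self_pow two_ne_zero _
    _ = 10 * (m * T * d) ^ 2 := by ring

lemma IsDualRun.le_measure_isTypical [∀ i, IsProbabilityMeasure (ν i)]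
    (h : IsDualRun T ν γ f oco P ℱ ξ θ p est I V)
    (hcube : ∀ i, ∀ᵐ v ∂(ν i), v ∈ unitCube d) (hQ : 2 ≤ m * T * d) {δ : ℝ} (hδ : 0 < δ)
    (hδ₁ : δ < 1) (hg : 6 * Real.log ((m : ℝ) * T * d / δ) ≤ g) :
    ENNReal.ofReal (1 - δ) ≤
      P {ω | IsTypical g T (meanMatrix ν) (est · ω) (p · ω) (I · ω) (V · ω)} := by
  have hQ' : (2 : ℝ) ≤ m * T * d := by exact_mod_cast hQ
  have hg₀ : 0 < g := by linarith [log_two_le_log_div hQ' hδ hδ₁, Real.log_pos one_lt_two]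
  have hcount : (2 * (T + 1) ^ 2 * (d * m) + 2 * d : ℝ) ≤ 10 * ((m : ℝ) * T * d) ^ 2 := by
    exact_mod_cast two_mul_succ_sq_mul_add_le hQ
  have hbad : P {ω | ¬ IsTypical g T (meanMatrix ν) (est · ω) (p · ω) (I · ω) (V · ω)} ≤
      ENNReal.ofReal δ := by
    refine (h.measure_not_isTypical_le hcube hg₀).trans ?_
    calc _ = ENNReal.ofReal ((2 * (T + 1) ^ 2 * (d * m) + 2 * d) * Real.exp (-g)) := by
          rw [ENNReal.ofReal_mul (by positivity)]
          norm_cast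
      _ ≤ ENNReal.ofReal δ := by
          gcongr
          exact (mul_le_mul_of_nonneg_right hcount (Real.exp_pos _).le).trans
            (mul_exp_neg_le hQ' hδ hδ₁ hg)
  rw [ENNReal.ofReal_sub _ hδ.le, ENNReal.ofReal_one, tsub_le_iff_right, ← measure_univ (μ := P)]
  exact (measure_univ_le_add_compl _).trans (add_le_add_right hbad _)

end Probability

section Regret

variable {q : ENNReal} [Fact (1 ≤ q)] {d m T : ℕ} {ν : Fin m → Measure (Fin d → ℝ)}
  [∀ i, IsProbabilityMeasure (ν i)] {γ g L δ : ℝ} {f : (Fin d → ℝ) → ℝ} {K : Set (Fin d → ℝ)}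
  {Ξ : Type*} {oco : OCOMethod K Ξ} {Ω : Type*} [mΩ : MeasurableSpace Ω] {P : Measure Ω}
  {ℱ : Filtration ℕ mΩ} {ξ : Ω → Ξ} {θ : ℕ → Ω → Fin d → ℝ} {p : ℕ → Ω → Fin m → ℝ}
  {est : ℕ → Ω → Matrix (Fin d) (Fin m) ℝ} {I : ℕ → Ω → Fin m} {V : ℕ → Ω → Fin d → ℝ}

namespace IsDualRun

lemma sub_le_of_isTypical (h : IsDualRun T ν (16 * g) f oco P ℱ ξ θ p est I V) (hT : 0 < T)
    (hm : 0 < m) (hcube : ∀ i, ∀ᵐ v ∂(ν i), v ∈ unitCube d) (hL : 0 ≤ L)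
    (hf : ConcaveOn ℝ (unitCube d) f)
    (hlip : ∀ x ∈ unitCube d, ∀ y ∈ unitCube d, f x - f y ≤ L * lqNorm q (x - y))
    (hg : 1 ≤ 8 * g) {ω : Ω}
    (hω : IsTypical g T (meanMatrix ν) (est · ω) (p · ω) (I · ω) (V · ω))
    {p' : Fin m → ℝ} (hp' : p' ∈ stdSimplex ℝ (Fin m)) :
    f (meanMatrix ν *ᵥ p') - f (avgObs T fun t => V t ω) ≤
      18 * (L * lqNorm q (1 : Fin d → ℝ) * √(16 * g * m / T)) +
        ocoRegret (dualBall q d L) T (fun t => dualLoss f (est t ω *ᵥ p t ω))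
          (fun t => θ t ω) / T := by
  have hM := meanMatrix_apply_mem hcube
  have hV (t : ℕ) (ht : t < T) : V t ω ∈ unitCube d := h.interaction.obs_mem t ht ω
  have hest (t : ℕ) (ht : t < T) := h.est_mem t ht ω
  have hx : avgObs T (fun t => est t ω *ᵥ p t ω) ∈ unitCube d :=
    avgObs_mem hT (convex_Icc 0 1) fun t ht =>
      mulVec_mem_unitCube (mem_Icc_of_mem_confBox (hest t ht)) (h.prob_mem t ht ω)
  -- Optimism: the mean matrix is a feasible choice of the algorithm.
  have hoptimism : f (meanMatrix ν *ᵥ p') - f (avgObs T fun t => est t ω *ᵥ p t ω) ≤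
      ocoRegret (dualBall q d L) T (fun t => dualLoss f (est t ω *ᵥ p t ω))
        (fun t => θ t ω) / T := by
    rw [le_div_iff₀' (by exact_mod_cast hT)]
    exact mul_sub_le_ocoRegret q hL hf hlip hx (mulVec_mem_unitCube hM hp') fun t ht =>
      h.minimal t ht ω p' hp' _ (hω.mem_confBox hV hM hg ht.le)
  have hclose : f (avgObs T fun t => est t ω *ᵥ p t ω) - f (avgObs T fun t => V t ω) ≤
      L * (18 * √(16 * g * m / T) * lqNorm q (1 : Fin d → ℝ)) := by
    refine (hlip _ hx _ (h.interaction.avgObs_mem_unitCube hT ω)).trans ?_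
    gcongr
    exact lqNorm_le_mul_lqNorm_one q (by positivity)
      (hω.abs_avgObs_sub_le hT hm hV hM hg hest fun t ht => h.prob_mem t ht ω)
  linarith

lemma le_measure_forall_sub_le [IsProbabilityMeasure P]
    (h : IsDualRun T ν γ f oco P ℱ ξ θ p est I V)
    (hcube : ∀ i, ∀ᵐ v ∂(ν i), v ∈ unitCube d) (hQ : 2 ≤ m * T * d) (hδ : 0 < δ) (hδ₁ : δ < 1)
    (hγ : 96 * Real.log ((m : ℝ) * T * d / δ) ≤ γ) (hf : ConcaveOn ℝ (unitCube d) f)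
    (hlip : ∀ x ∈ unitCube d, ∀ y ∈ unitCube d, f x - f y ≤ L * lqNorm q (x - y)) :
    ENNReal.ofReal (1 - δ) ≤ P {ω | ∀ p' ∈ stdSimplex ℝ (Fin m),
      f (meanMatrix ν *ᵥ p') - f (avgObs T fun t => V t ω) ≤
        18 * (L * lqNorm q (1 : Fin d → ℝ) * √(γ * m / T)) +
          ocoRegret (dualBall q d L) T (fun t => dualLoss f (est t ω *ᵥ p t ω))
            (fun t => θ t ω) / T} := by
  obtain ⟨g, rfl⟩ : ∃ g, γ = 16 * g := ⟨γ / 16, by ring⟩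
  obtain ⟨hm, hT, hd⟩ := pos_of_two_le_mul_mul hQ
  have hlog : Real.log 2 ≤ Real.log ((m : ℝ) * T * d / δ) :=
    log_two_le_log_div (by exact_mod_cast hQ) hδ hδ₁
  have hg : 1 ≤ 8 * g := by linarith [Real.log_two_gt_d9]
  refine (h.le_measure_isTypical hcube hQ hδ hδ₁ (g := g) (by linarith)).trans (measure_mono ?_)
  exact fun ω hω p' hp' => h.sub_le_of_isTypical hT hm hcube
    (zero_le_of_sub_le_mul_lqNorm q hd hlip) hf hlip hg hω hp'

end IsDualRun

end Regret

end BwCR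

end

theorem theorem3_general (q : ENNReal) [Fact (1 ≤ q)] {d m T : ℕ} {δ γ : ℝ}
    (hQ : 2 ≤ m * T * d) (hδ : 0 < δ) (hδ₁ : δ < 1)
    (hγ : 96 * Real.log ((m : ℝ) * T * d / δ) ≤ γ) {ν : Fin m → Measure (Fin d → ℝ)}
    [∀ i, IsProbabilityMeasure (ν i)] (hcube : ∀ i, ∀ᵐ v ∂(ν i), v ∈ BwCR.unitCube d)
    {Ω : Type*} {mΩ : MeasurableSpace Ω} {P : Measure Ω} [IsProbabilityMeasure P]
    {ℱ : Filtration ℕ mΩ} {Ξ : Type*} {ξ : Ω → Ξ} {θ : ℕ → Ω → Fin d → ℝ}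
    {p : ℕ → Ω → Fin m → ℝ} {est : ℕ → Ω → Matrix (Fin d) (Fin m) ℝ} {I : ℕ → Ω → Fin m}
    {V : ℕ → Ω → Fin d → ℝ} {K : Set (Fin d → ℝ)} (oco : BwCR.OCOMethod K Ξ) :
    (∀ (f : (Fin d → ℝ) → ℝ) (L : ℝ),
      ConcaveOn ℝ (BwCR.unitCube d) f →
      (∀ x ∈ BwCR.unitCube d, ∀ y ∈ BwCR.unitCube d,
        f x - f y ≤ L * BwCR.lqNorm q (x - y)) →
      BwCR.IsDualRun T ν γ f oco P ℱ ξ θ p est I V →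
      ENNReal.ofReal (1 - δ) ≤ P {ω |
        BwCR.optValue T ν f - f (BwCR.avgObs T fun t => V t ω) ≤
          18 * (L * BwCR.lqNorm q (1 : Fin d → ℝ) * √(γ * m / T)) +
            BwCR.ocoRegret (BwCR.dualBall q d L) T
              (fun t => BwCR.dualLoss f (est t ω *ᵥ p t ω)) (fun t => θ t ω) / T}) ∧
    (∀ S : Set (Fin d → ℝ),
      Convex ℝ S →
      (∃ p' ∈ stdSimplex ℝ (Fin m), BwCR.meanMatrix ν *ᵥ p' ∈ S) →
      BwCR.IsDualRun T ν γ (fun x => -BwCR.lqDist q x S) oco P ℱ ξ θ p est I V →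
      ENNReal.ofReal (1 - δ) ≤ P {ω |
        BwCR.lqDist q (BwCR.avgObs T fun t => V t ω) S ≤
          18 * (BwCR.lqNorm q (1 : Fin d → ℝ) * √(γ * m / T)) +
            BwCR.ocoRegret (BwCR.dualBall q d 1) T
              (fun t => BwCR.dualLoss (fun x => -BwCR.lqDist q x S) (est t ω *ᵥ p t ω))
              (fun t => θ t ω) / T}) := by
  refine ⟨fun f L hf hlip h => ?_, fun S hS ⟨p', hp', hp'S⟩ h => ?_⟩
  · obtain ⟨hm, hT, -⟩ := BwCR.pos_of_two_le_mul_mul hQ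
    refine (h.le_measure_forall_sub_le hcube hQ hδ hδ₁ hγ hf hlip).trans (measure_mono ?_)
    exact fun ω hω => sub_le_iff_le_add.2 (BwCR.optValue_le hT hm hcube hf
      (BwCR.continuousOn_of_sub_le_mul_lqNorm q hlip) fun p' hp' => sub_le_iff_le_add.1 (hω p' hp'))
  · have hconcave : ConcaveOn ℝ (BwCR.unitCube d) fun x => -BwCR.lqDist q x S :=
      ((BwCR.convexOn_lqDist q hS ⟨_, hp'S⟩).subset (Set.subset_univ _) (convex_Icc 0 1)).neg
    have hlip (x) (_ : x ∈ BwCR.unitCube d) (y) (_ : y ∈ BwCR.unitCube d) :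
        -BwCR.lqDist q x S - -BwCR.lqDist q y S ≤ 1 * BwCR.lqNorm q (x - y) := by
      rw [neg_sub_neg, one_mul, BwCR.lqNorm_sub_comm]
      exact BwCR.lqDist_sub_le q S y x
    refine (h.le_measure_forall_sub_le hcube hQ hδ hδ₁ hγ hconcave hlip).trans (measure_mono ?_)
    intro ω hω
    simpa [BwCR.lqDist_of_mem q hp'S] using hω p' hp'

theorem theorem3 :
    ∃ c₀ : ℝ, 0 < c₀ ∧ ∃ C : ℝ, 0 < C ∧
      ∀ (q : ENNReal) [Fact (1 ≤ q)] (d m T : ℕ) (δ γ : ℝ),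
        2 ≤ m * T * d → 0 < δ → δ < 1 →
        c₀ * Real.log ((m : ℝ) * T * d / δ) ≤ γ →
      ∀ (ν : Fin m → Measure (Fin d → ℝ)),
        (∀ i, IsProbabilityMeasure (ν i)) →
        (∀ i, ∀ᵐ v ∂(ν i), v ∈ BwCR.unitCube d) →
      ∀ (Ω : Type*) (mΩ : MeasurableSpace Ω) (P : Measure Ω) [IsProbabilityMeasure P]
        (ℱ : Filtration ℕ mΩ) (Ξ : Type*) (ξ : Ω → Ξ)
        (θ : ℕ → Ω → Fin d → ℝ) (p : ℕ → Ω → Fin m → ℝ)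
        (est : ℕ → Ω → Matrix (Fin d) (Fin m) ℝ)
        (I : ℕ → Ω → Fin m) (V : ℕ → Ω → Fin d → ℝ),
        -- concave rewards
        (∀ (f : (Fin d → ℝ) → ℝ) (L : ℝ),
          ConcaveOn ℝ (BwCR.unitCube d) f →
          (∀ x ∈ BwCR.unitCube d, f x ∈ Set.Icc (0 : ℝ) 1) →
          (∀ x ∈ BwCR.unitCube d, ∀ y ∈ BwCR.unitCube d,
            f x - f y ≤ L * BwCR.lqNorm q (x - y)) →
          ∀ oco : BwCR.OCOMethod (BwCR.dualBall q d L) Ξ,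
            BwCR.IsDualRun T ν γ f oco P ℱ ξ θ p est I V →
            ENNReal.ofReal (1 - δ) ≤ P {ω |
              BwCR.optValue T ν f - f (BwCR.avgObs T fun t => V t ω) ≤
                C * (L * BwCR.lqNorm q (1 : Fin d → ℝ) * Real.sqrt (γ * m / T)) +
                  BwCR.ocoRegret (BwCR.dualBall q d L) T
                    (fun t => BwCR.dualLoss f (est t ω *ᵥ p t ω)) (fun t => θ t ω) / T}) ∧
        -- convex knapsacks
        (∀ S : Set (Fin d → ℝ),
          Convex ℝ S →
          (∃ p' ∈ stdSimplex ℝ (Fin m), BwCR.meanMatrix ν *ᵥ p' ∈ S) →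
          ∀ oco : BwCR.OCOMethod (BwCR.dualBall q d 1) Ξ,
            BwCR.IsDualRun T ν γ (fun x => -BwCR.lqDist q x S) oco P ℱ ξ θ p est I V →
            ENNReal.ofReal (1 - δ) ≤ P {ω |
              BwCR.lqDist q (BwCR.avgObs T fun t => V t ω) S ≤
                C * (BwCR.lqNorm q (1 : Fin d → ℝ) * Real.sqrt (γ * m / T)) +
                  BwCR.ocoRegret (BwCR.dualBall q d 1) T
                    (fun t => BwCR.dualLoss (fun x => -BwCR.lqDist q x S) (est t ω *ᵥ p t ω))
                    (fun t => θ t ω) / T}) := by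
  refine ⟨96, by norm_num, 18, by norm_num, ?_⟩
  intro q _ d m T δ γ hQ hδ hδ₁ hγ ν _ hcube Ω _ P _ ℱ Ξ ξ θ p est I V
  exact ⟨fun f L hf _ hlip oco => (theorem3_general q hQ hδ hδ₁ hγ hcube oco).1 f L hf hlip,
    fun S hS hp' oco => (theorem3_general q hQ hδ hδ₁ hγ hcube oco).2 S hS hp'⟩
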